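/- Let $\mathcal H$ (state space) and $\mathcal V$ (control space) be real Hilbert spaces, $T>0$, $B\in\mathcal L(\mathcal V;\mathcal H)$, and $N\in\mathcal L(\mathcal V;\mathcal V)$ self-adjoint, nonnegative ($(v,Nv)\ge 0$ for all $v$) and invertible. Let $A:\mathcal H\to\mathcal H$ be $C^1$ with $DA$ differentiable, let $F,F_T:\mathcal H\to\mathbb R$ be $C^2$, and let $\gamma,b,\nu,M,\nu_T,M_T,m,k$ be real constants such that, for all $x,x_1,x_2,\xi\in\mathcal H$: - $A(0)=0$, $\|DA(x)\|\le\gamma$, and $\|DA(x_1)-DA(x_2)\|\le \dfrac{b|x_1-x_2|}{1+\max(|x_1|,|x_2|)}$; - $F(0)=0$, $DF(0)=0$, $\nu|\xi|^2\le (D^2F(x)\xi,\xi)\le M|\xi|^2$, with $\nu>0$; - $F_T(0)=0$, $DF_T(0)=0$, $\nu_T|\xi|^2\le (D^2F_T(x)\xi,\xi)\le M_T|\xi|^2$, with $\nu_T>0$; - $(BN^{-1}B^*\xi,\xi)\ge m|\xi|^2$, with $m>0$; - $0<k<\min(m,\nu)$ and $\dfrac{b^2}{16}<(m-k)(\nu-k)$;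 - $\nu-b\left(\dfrac{M_T^2}{\nu_T}+\dfrac{\gamma^2+M^2}{k}T\right)>0$ and $\gamma^2<M\|BN^{-1}B^*\|$. For $x\in\mathcal H$, $t\in[0,T]$ and $v\in L^2(t,T;\mathcal V)$, let $x(\cdot)\in H^1(t,T;\mathcal H)$ solve $\dfrac{dx}{ds}=A(x(s))+Bv(s)$, $x(t)=x$, and put $$J_{xt}(v)=\int_t^T F(x(s))\,ds+F_T(x(T))+\frac12\int_t^T (v(s),Nv(s))\,ds,\qquad V(x,t)=\inf_{v\in L^2(t,T;\mathcal V)}J_{xt}(v).$$ Then, for every $x\in\mathcal H$ and $t\in[0,T]$, the infimum $V(x,t)$ is finite, and the forward-backward system $$\frac{dy}{ds}=A(y(s))-BN^{-1}B^*z(s),\quad -\frac{dz}{ds}=(DA(y(s)))^*z(s)+DF(y(s)),\quad t<s<T,\qquad y(t)=x,\quad z(T)=DF_T(y(T)),$$ has exactly one solution $(y,z)$, continuous on $[t,T]$. Let $\Gamma(x,t):=z(t)$ be the decoupling function so defined. Then $z(s)=\Gamma(y(s),s)$ for all $s\in[t,T]$, and $V(\cdot,t)$ is (Fréchet) differentiable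 at $x$ with gradient $$D_xV(x,t)=\Gamma(x,t).$$ -/

import Mathlib

open Set MeasureTheory

noncomputable section

namespace HilbertControl

/-- The data of the control problem on the state space `H` and the control space `U`: the drift
`A`, the running and terminal costs `F` and `FT`, the bounded control operator `B`, the invertible
bounded operator `N` weighting the control, and the horizon `T`. -/
structure Problem (H U : Type*)
    [NormedAddCommGroup H] [InnerProductSpace ℝ H] [CompleteSpace H]
    [NormedAddCommGroup U] [InnerProductSpace ℝ U] [CompleteSpace U] where
  A : H → H
  F : H → ℝ
  FT : H → ℝ
  B : U →L[ℝ] H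
  N : U ≃L[ℝ] U
  T : ℝ

variable {H U : Type*}
  [NormedAddCommGroup H] [InnerProductSpace ℝ H] [CompleteSpace H]
  [NormedAddCommGroup U] [InnerProductSpace ℝ U] [CompleteSpace U]

namespace Problem

/-- The operator `B N⁻¹ B*` on the state space. -/
def BNB (P : Problem H U) : H →L[ℝ] H :=
  P.B ∘L (P.N.symm : U →L[ℝ] U) ∘L ContinuousLinearMap.adjoint P.B

/-- `X` is the state on `[t, T]` started at `x` at time `t` and driven by the control `v`:
`dX/ds = A(X) + B v(s)`, `X(t) = x`. For `v ∈ L²(t,T)` this integrated form says exactly that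
`X ∈ H¹(t,T)` (continuous representative) solves the equation almost everywhere. -/
def IsState (P : Problem H U) (x : H) (t : ℝ) (v : ℝ → U) (X : ℝ → H) : Prop :=
  ContinuousOn X (Icc t P.T) ∧
    ∀ s ∈ Icc t P.T, X s = x + ∫ r in t..s, (P.A (X r) + P.B (v r))

/-- The payoff of the control `v` with associated state `X` on `[t, T]`. -/
def cost (P : Problem H U) (t : ℝ) (v : ℝ → U) (X : ℝ → H) : ℝ :=
  (∫ s in t..P.T, P.F (X s)) + P.FT (X P.T)
    + (1 / 2) * ∫ s in t..P.T, inner ℝ (v s) (P.N (v s))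

/-- All payoffs `J_{xt}(v)`, where `v` ranges over `L²(t,T;U)`. -/
def payoffs (P : Problem H U) (x : H) (t : ℝ) : Set ℝ :=
  {c | ∃ (v : ℝ → U) (X : ℝ → H), MemLp v 2 (volume.restrict (Ioc t P.T)) ∧
    P.IsState x t v X ∧ c = P.cost t v X}

/-- The value function `V(x,t) = inf_v J_{xt}(v)`. -/
def value (P : Problem H U) (x : H) (t : ℝ) : ℝ := sInf (P.payoffs x t)

/-- `(y, z)` solves the forward-backward system on `[t, T]` with `y(t) = x`. -/
structure IsFBSolution (P : Problem H U) (x : H) (t : ℝ) (y z : ℝ → H) : Prop where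
  y_cont : ContinuousOn y (Icc t P.T)
  z_cont : ContinuousOn z (Icc t P.T)
  forward : ∀ s ∈ Ioo t P.T, HasDerivAt y (P.A (y s) - P.BNB (z s)) s
  backward : ∀ s ∈ Ioo t P.T, HasDerivAt z
    (-(ContinuousLinearMap.adjoint (fderiv ℝ P.A (y s)) (z s) + gradient P.F (y s))) s
  initial : y t = x
  terminal : z P.T = gradient P.FT (y P.T)

open Classical in
/-- The decoupling function `Γ(x,t) = z(t)`, where `(y, z)` is the solution of the
forward-backward system on `[t, T]` with `y(t) = x` (with value `0` if there is no solution). -/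
def decoupling (P : Problem H U) (x : H) (t : ℝ) : H :=
  if h : ∃ p : (ℝ → H) × (ℝ → H), P.IsFBSolution x t p.1 p.2 then h.choose.2 t else 0

/-- The standing assumptions, with constants `γ, b, ν, M, νT, MT, m, k`. -/
structure Assumptions (P : Problem H U) (γ b ν M νT MT m k : ℝ) : Prop where
  T_pos : 0 < P.T
  -- the drift
  A_zero : P.A 0 = 0
  A_C1 : ContDiff ℝ 1 P.A
  A_diff2 : Differentiable ℝ (fderiv ℝ P.A)
  A_bound : ∀ x, ‖fderiv ℝ P.A x‖ ≤ γ
  A_lip : ∀ x₁ x₂, ‖fderiv ℝ P.A x₁ - fderiv ℝ P.A x₂‖ ≤ b * ‖x₁ - x₂‖ / (1 + max ‖x₁‖ ‖x₂‖)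
  -- the running cost
  F_C2 : ContDiff ℝ 2 P.F
  F_zero : P.F 0 = 0
  DF_zero : gradient P.F 0 = 0
  ν_pos : 0 < ν
  F_lower : ∀ x ξ, ν * ‖ξ‖ ^ 2 ≤ inner ℝ (fderiv ℝ (gradient P.F) x ξ) ξ
  F_upper : ∀ x ξ, inner ℝ (fderiv ℝ (gradient P.F) x ξ) ξ ≤ M * ‖ξ‖ ^ 2
  -- the terminal cost
  FT_C2 : ContDiff ℝ 2 P.FT
  FT_zero : P.FT 0 = 0
  DFT_zero : gradient P.FT 0 = 0
  νT_pos : 0 < νT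
  FT_lower : ∀ x ξ, νT * ‖ξ‖ ^ 2 ≤ inner ℝ (fderiv ℝ (gradient P.FT) x ξ) ξ
  FT_upper : ∀ x ξ, inner ℝ (fderiv ℝ (gradient P.FT) x ξ) ξ ≤ MT * ‖ξ‖ ^ 2
  -- the control operators
  N_selfAdjoint : IsSelfAdjoint (P.N : U →L[ℝ] U)
  N_nonneg : ∀ v, 0 ≤ inner ℝ v (P.N v)
  m_pos : 0 < m
  BNB_lower : ∀ ξ, m * ‖ξ‖ ^ 2 ≤ inner ℝ (P.BNB ξ) ξ
  -- the relations between the constants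
  k_pos : 0 < k
  k_lt : k < min m ν
  b_small : b ^ 2 / 16 < (m - k) * (ν - k)
  b_small' : 0 < ν - b * (MT ^ 2 / νT + (γ ^ 2 + M ^ 2) / k * P.T)
  γ_small : γ ^ 2 < M * ‖P.BNB‖

end Problem

end HilbertControl

end

/-! Everything rests on the pairing of `y` with `z`. Along a solution of the forward-backward system
its derivative is at most `-k (‖y‖² + ‖z‖²)`, because `b² / 16` is small; integration gives `‖z s‖ ≤
C ‖y s‖` (`energy_estimate`, `norm_costate_le`). For the difference of two solutions the terms in
`A` reduce to two first order Taylor remainders paired with costates. The weight `1 / (1 + ‖y‖)` in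
the bound on `DA`, combined with `‖z‖ ≤ C ‖y‖`, makes them quadratic with total constant `b C`,
which `ν > b C` absorbs. Hence uniqueness, and a Lipschitz bound of the costate in the state
(`energy_sub`).

For existence, the system is solved backward from an arbitrary terminal state, and every `x` is
shown to be reached at time `t`. By the Lipschitz bound, over a step whose length does not depend on
the data, the map from `y t₀` to `y t` is the identity plus a contraction, hence onto; finitely many
steps cover `[0, T]`.

Finally, integration by parts and the same absorption show that any control started at `x'` costs at
least the extremal cost from `x` plus `(x' - x, z t)` (`cost_feedback_add_inner_le`). The case `x' =
x` gives optimality of the feedback; in general `Γ(x, t)` is a subgradient of the value, and a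
Lipschitz field of subgradients is a gradient. -/

namespace HilbertControl

open Filter Topology Metric NNReal

/-! ### Global existence for differential equations with linear growth. -/

section ODE

variable {E : Type*} [NormedAddCommGroup E] [NormedSpace ℝ E]

/-- Multiplying a vector field that is Lipschitz on a ball by a Lipschitz cutoff supported in that
ball gives a globally Lipschitz vector field. -/
theorem lipschitzWith_cutoff_smul {f : E → E} {R C : ℝ} {L : ℝ≥0}
    (hC : 0 ≤ C) (hf : LipschitzOnWith L f (closedBall 0 (R + 1)))
    (hb : ∀ w ∈ closedBall (0 : E) (R + 1), ‖f w‖ ≤ C) :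
    LipschitzWith (C.toNNReal + L) fun w => max 0 (min 1 (R + 1 - ‖w‖)) • f w := by
  set χ : E → ℝ := fun w => max 0 (min 1 (R + 1 - ‖w‖)) with hχ
  have hχ0 : ∀ w, 0 ≤ χ w := fun w => le_max_left _ _
  have hχ1 : ∀ w, χ w ≤ 1 := fun w => max_le zero_le_one (min_le_left _ _)
  have hχL : ∀ u v, |χ u - χ v| ≤ ‖u - v‖ := by
    intro u v
    have h1 := abs_max_sub_max_le_abs (min 1 (R + 1 - ‖u‖)) (min 1 (R + 1 - ‖v‖)) 0
    have h2 := abs_min_sub_min_le_max 1 (R + 1 - ‖u‖) 1 (R + 1 - ‖v‖)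
    have h3 := abs_norm_sub_norm_le v u
    rw [norm_sub_rev] at h3
    simp only [sub_self, abs_zero] at h2
    have h4 : R + 1 - ‖u‖ - (R + 1 - ‖v‖) = ‖v‖ - ‖u‖ := by ring
    rw [h4, max_eq_right (abs_nonneg _)] at h2
    simp only [hχ, max_comm (0 : ℝ)]
    linarith
  have hout : ∀ w, w ∉ closedBall (0 : E) (R + 1) → χ w = 0 := by
    intro w hw
    simp only [mem_closedBall, dist_zero_right, not_le] at hw
    exact max_eq_left ((min_le_right _ _).trans (by linarith))
  have key : ∀ u ∈ closedBall (0 : E) (R + 1), ∀ v,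
      ‖χ u • f u - χ v • f v‖ ≤ (C + L) * ‖u - v‖ := by
    intro u hu v
    have h0 : ‖(χ u - χ v) • f u‖ ≤ C * ‖u - v‖ := by
      rw [norm_smul, Real.norm_eq_abs, mul_comm]
      exact mul_le_mul (hb u hu) (hχL u v) (abs_nonneg _) hC
    by_cases hv : v ∈ closedBall (0 : E) (R + 1)
    · have h1 : ‖χ v • (f u - f v)‖ ≤ L * ‖u - v‖ := by
        rw [norm_smul, Real.norm_eq_abs, abs_of_nonneg (hχ0 v)]
        have := hf.norm_sub_le hu hv
        nlinarith [hχ0 v, hχ1 v, norm_nonneg (f u - f v)]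
      calc ‖χ u • f u - χ v • f v‖ = ‖(χ u - χ v) • f u + χ v • (f u - f v)‖ := by
            congr 1; module
        _ ≤ _ := by
            refine (norm_add_le _ _).trans ?_
            linarith
    · have := hout v hv
      rw [this] at h0 ⊢
      simp only [sub_zero, zero_smul] at h0 ⊢
      have : 0 ≤ (L : ℝ) * ‖u - v‖ := by positivity
      linarith
  refine LipschitzWith.of_dist_le_mul fun u v => ?_
  rw [dist_eq_norm, dist_eq_norm, NNReal.coe_add, Real.coe_toNNReal C hC]
  by_cases hu : u ∈ closedBall (0 : E) (R + 1)
  · exact key u hu v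
  · by_cases hv : v ∈ closedBall (0 : E) (R + 1)
    · rw [norm_sub_rev, norm_sub_rev u]
      exact key v hv u
    · change ‖χ u • f u - χ v • f v‖ ≤ _
      rw [hout u hu, hout v hv]
      simp only [zero_smul, sub_self, norm_zero]
      positivity

/-- Global existence for autonomous equations whose field is Lipschitz on balls and has linear
growth. -/
theorem exists_hasDerivWithinAt_of_linear_growth [CompleteSpace E] {f : E → E} {K T : ℝ}
    (hK : 0 ≤ K) (hT : 0 ≤ T) (hb : ∀ w, ‖f w‖ ≤ K * ‖w‖)
    (hf : ∀ R : ℝ, ∃ L : ℝ≥0, LipschitzOnWith L f (closedBall 0 R)) (w₀ : E) :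
    ∃ w : ℝ → E, w 0 = w₀ ∧ ∀ s ∈ Icc 0 T, HasDerivWithinAt w (f (w s)) (Icc 0 T) s := by
  -- Grönwall's bound for the solution on `[0, T]`; the cutoff equals 1 on this ball.
  set R : ℝ := ‖w₀‖ * Real.exp (K * T) with hR
  have hR0 : 0 ≤ R := by positivity
  obtain ⟨L, hL⟩ := hf (R + 1)
  set g : E → E := fun w => max 0 (min 1 (R + 1 - ‖w‖)) • f w with hg
  have hχ1 : ∀ w : E, ‖max 0 (min 1 (R + 1 - ‖w‖))‖ ≤ 1 := fun w => by
    rw [Real.norm_eq_abs, abs_of_nonneg (le_max_left _ _)]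
    exact max_le zero_le_one (min_le_left _ _)
  have hgf : ∀ w, ‖g w‖ ≤ K * ‖w‖ := fun w => by
    rw [hg, norm_smul]
    exact (mul_le_of_le_one_left (norm_nonneg _) (hχ1 w)).trans (hb w)
  have hC : 0 ≤ K * (R + 1) := by positivity
  have hfb : ∀ w ∈ closedBall (0 : E) (R + 1), ‖f w‖ ≤ K * (R + 1) := fun w hw => by
    refine (hb w).trans (mul_le_mul_of_nonneg_left ?_ hK)
    simpa using hw
  have hgC : ∀ w, ‖g w‖ ≤ K * (R + 1) := by
    intro w
    by_cases hw : w ∈ closedBall (0 : E) (R + 1)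
    · refine (hgf w).trans (mul_le_mul_of_nonneg_left ?_ hK)
      simpa using hw
    · simp only [mem_closedBall, dist_zero_right, not_le] at hw
      have : max 0 (min 1 (R + 1 - ‖w‖)) = 0 :=
        max_eq_left ((min_le_right _ _).trans (by linarith))
      simp only [hg, this, zero_smul, norm_zero]
      exact hC
  -- The truncated field is bounded, so a ball of radius bound times `T` gives existence on all of
  -- `[0, T]` at once.
  have hPL : IsPicardLindelof (fun _ : ℝ => g) (tmin := 0) (tmax := T) ⟨0, by simp [hT]⟩ w₀
      ((K * (R + 1)).toNNReal * T.toNNReal) 0 (K * (R + 1)).toNNReal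
      ((K * (R + 1)).toNNReal + L) :=
    { lipschitzOnWith := fun _ _ => (lipschitzWith_cutoff_smul hC hL hfb).lipschitzOnWith
      continuousOn := fun _ _ => continuousOn_const
      norm_le := fun _ _ w _ => by
        rw [Real.coe_toNNReal _ hC]
        exact hgC w
      mul_max_le := by
        simp [hT] }
  obtain ⟨w, hw0, hw⟩ := hPL.exists_eq_forall_mem_Icc_hasDerivWithinAt₀
  refine ⟨w, hw0, fun s hs => ?_⟩
  have hcont : ContinuousOn w (Icc 0 T) := fun s hs => (hw s hs).continuousWithinAt
  -- The truncated field keeps the growth bound of `f`, so its solution never meets the cutoff and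
  -- solves the original equation.
  have hbd := norm_le_gronwallBound_of_norm_deriv_right_le (f := w) (f' := fun s => g (w s))
    (δ := ‖w₀‖) (K := K) (ε := 0) hcont
    (fun s hs => ((hw s (Ico_subset_Icc_self hs)).mono_of_mem_nhdsWithin
      (Icc_mem_nhdsGE_of_mem hs)))
    (by rw [← hw0]) (fun s _ => by simpa using hgf (w s)) s hs
  rw [sub_zero, gronwallBound_ε0] at hbd
  have hws : ‖w s‖ ≤ R := by
    refine hbd.trans ?_
    rw [hR]
    gcongr
    exact hs.2
  have hgs : g (w s) = f (w s) := by
    have : max 0 (min 1 (R + 1 - ‖w s‖)) = 1 := by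
      rw [min_eq_left (by linarith)]
      simp
    simp only [hg, this, one_smul]
  rw [← hgs]
  exact hw s hs

end ODE

/-! ### Integration by parts for indefinite integrals in a Hilbert space. -/

section ByParts

/-- The variation sums compare term by term. This serves both for vector-valued primitives, against
the primitive of the norm, and for inner products. -/
theorem absolutelyContinuousOnInterval_of_dist_le {X Y Z : Type*} [PseudoMetricSpace X]
    [PseudoMetricSpace Y] [PseudoMetricSpace Z] {f : ℝ → X} {g : ℝ → Y} {h : ℝ → Z}
    {a b C D : ℝ} (hg : AbsolutelyContinuousOnInterval g a b)
    (hh : AbsolutelyContinuousOnInterval h a b)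
    (hf : ∀ x ∈ uIcc a b, ∀ y ∈ uIcc a b,
      dist (f x) (f y) ≤ C * dist (g x) (g y) + D * dist (h x) (h y)) :
    AbsolutelyContinuousOnInterval f a b := by
  unfold AbsolutelyContinuousOnInterval at hg hh
  apply squeeze_zero' ?_ ?_ (by simpa using (hg.const_mul C).add (hh.const_mul D))
  · exact Filter.Eventually.of_forall fun _ => Finset.sum_nonneg fun i _ => dist_nonneg
  rw [eventually_inf_principal]
  filter_upwards with ⟨n, I⟩ hnI
  simp only [Finset.mul_sum, ← Finset.sum_add_distrib]
  exact Finset.sum_le_sum fun i hi => hf _ (hnI.left i hi).1 _ (hnI.left i hi).2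

theorem absolutelyContinuousOnInterval_integral {E : Type*} [NormedAddCommGroup E]
    [NormedSpace ℝ E] {w : ℝ → E} {a b : ℝ} (hw : IntervalIntegrable w volume a b) (c : E) :
    AbsolutelyContinuousOnInterval (fun s => c + ∫ r in a..s, w r) a b := by
  have h := hw.norm.absolutelyContinuousOnInterval_intervalIntegral (c := a) left_mem_uIcc
  refine absolutelyContinuousOnInterval_of_dist_le (C := 1) (D := 0) h h fun x hx y hy => ?_
  have hi : ∀ {u v}, u ∈ uIcc a b → v ∈ uIcc a b → IntervalIntegrable w volume u v :=
    fun hu hv => hw.mono_set (uIcc_subset_uIcc hu hv)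
  have ha : a ∈ uIcc a b := left_mem_uIcc
  rw [dist_add_left, dist_eq_norm, Real.dist_eq,
    intervalIntegral.integral_interval_sub_left (hi ha hx) (hi ha hy),
    intervalIntegral.integral_interval_sub_left (hi ha hx).norm (hi ha hy).norm]
  simpa using intervalIntegral.norm_integral_le_abs_integral_norm

variable {H : Type*} [NormedAddCommGroup H] [InnerProductSpace ℝ H] [CompleteSpace H]

/-- Integration by parts for the inner product of two indefinite integrals. -/
theorem integral_inner_add_inner {δ ζ w₁ w₂ : ℝ → H} {a b : ℝ} (hab : a ≤ b)
    (hw₁ : IntervalIntegrable w₁ volume a b) (hw₂ : IntervalIntegrable w₂ volume a b)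
    (hδ : ∀ s ∈ Icc a b, δ s = δ a + ∫ r in a..s, w₁ r)
    (hζ : ∀ s ∈ Icc a b, ζ s = ζ a + ∫ r in a..s, w₂ r) :
    ∫ s in a..b, (inner ℝ (w₁ s) (ζ s) + inner ℝ (δ s) (w₂ s)) =
      inner ℝ (δ b) (ζ b) - inner ℝ (δ a) (ζ a) := by
  -- The integral formulas for `δ` and `ζ` hold only on `[a, b]`; these primitives are defined on
  -- the whole line, so they can be differentiated almost everywhere.
  set d : ℝ → H := fun s => δ a + ∫ r in a..s, w₁ r with hd
  set e : ℝ → H := fun s => ζ a + ∫ r in a..s, w₂ r with he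
  have hdAC : AbsolutelyContinuousOnInterval d a b := absolutelyContinuousOnInterval_integral hw₁ _
  have heAC : AbsolutelyContinuousOnInterval e a b := absolutelyContinuousOnInterval_integral hw₂ _
  obtain ⟨C, hC⟩ := hdAC.exists_bound
  obtain ⟨D, hD⟩ := heAC.exists_bound
  have hAC : AbsolutelyContinuousOnInterval (fun s => inner ℝ (d s) (e s) : ℝ → ℝ) a b := by
    refine absolutelyContinuousOnInterval_of_dist_le (C := D) (D := C) hdAC heAC
      fun x hx y hy => ?_
    rw [dist_eq_norm, dist_eq_norm, dist_eq_norm]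
    have : inner ℝ (d x) (e x) - inner ℝ (d y) (e y)
        = inner ℝ (d x - d y) (e x) + inner ℝ (d y) (e x - e y) := by
      rw [inner_sub_left, inner_sub_right]; ring
    rw [this]
    refine (norm_add_le _ _).trans (add_le_add ?_ ?_)
    · rw [mul_comm]
      exact (norm_inner_le_norm _ _).trans (by gcongr; exact hD x hx)
    · exact (norm_inner_le_norm _ _).trans (by gcongr; exact hC y hy)
  have h := hAC.integral_deriv_eq_sub
  have ha : a ∈ Icc a b := left_mem_Icc.2 hab
  have hb : b ∈ Icc a b := right_mem_Icc.2 hab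
  rw [hδ b hb, hζ b hb]
  have hda : d a = δ a := by simp [hd]
  have hea : e a = ζ a := by simp [he]
  rw [hda, hea] at h
  rw [← h]
  refine intervalIntegral.integral_congr_ae ?_
  filter_upwards [hw₁.ae_hasDerivAt_integral, hw₂.ae_hasDerivAt_integral] with s h₁ h₂ hs
  have hs' : s ∈ uIcc a b := uIoc_subset_uIcc hs
  have hs'' : s ∈ Icc a b := by rwa [uIcc_of_le hab] at hs'
  have h₁' := (h₁ hs' a left_mem_uIcc).const_add (δ a)
  have h₂' := (h₂ hs' a left_mem_uIcc).const_add (ζ a)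
  have h₃ : HasDerivAt (fun s => inner ℝ (d s) (e s)) _ s := h₁'.inner ℝ h₂'
  rw [h₃.deriv, hδ s hs'', hζ s hs'', add_comm]

end ByParts

/-! ### Energy and short-time estimates for pairs of curves. -/

section Energy

/-- Cauchy–Schwarz, read off from the nonnegative variance of `g` about its mean `c`. -/
theorem sq_integral_le_mul_integral_sq {g : ℝ → ℝ} {a b : ℝ} (hab : a ≤ b)
    (hg : ContinuousOn g (Icc a b)) :
    (∫ s in a..b, g s) ^ 2 ≤ (b - a) * ∫ s in a..b, g s ^ 2 := by
  rcases hab.eq_or_lt with rfl | hlt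
  · simp
  have hi : IntervalIntegrable g volume a b := hg.intervalIntegrable_of_Icc hab
  have hi2 : IntervalIntegrable (fun s => g s ^ 2) volume a b :=
    (hg.pow 2).intervalIntegrable_of_Icc hab
  set c : ℝ := (∫ s in a..b, g s) / (b - a) with hc
  have h0 : 0 ≤ ∫ s in a..b, (g s - c) ^ 2 :=
    intervalIntegral.integral_nonneg hab fun s _ => sq_nonneg _
  have h1 : ∫ s in a..b, (g s - c) ^ 2
      = (∫ s in a..b, g s ^ 2) - 2 * c * (∫ s in a..b, g s) + (b - a) * c ^ 2 := by
    have : ∀ s, (g s - c) ^ 2 = g s ^ 2 - 2 * c * g s + c ^ 2 := fun s => by ring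
    simp only [this]
    rw [intervalIntegral.integral_add (hi2.sub (hi.const_mul _)) (by simp),
      intervalIntegral.integral_sub hi2 (hi.const_mul _), intervalIntegral.integral_const_mul]
    simp
  have hL : 0 < b - a := sub_pos.2 hlt
  have h2 : ∫ s in a..b, g s = c * (b - a) := by rw [hc]; field_simp
  rw [h1, h2] at h0
  rw [h2]
  nlinarith

variable {H : Type*} [NormedAddCommGroup H] [InnerProductSpace ℝ H] [CompleteSpace H]

/-- The coercivity estimate for a pair `(η, ζ)` along which the pairing `(η, ζ)` dissipates. -/
theorem energy_estimate {η ζ η' ζ' : ℝ → H} {a b α β p r c d : ℝ} (hab : a ≤ b)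
    (hη : ContinuousOn η (Icc a b)) (hζ : ContinuousOn ζ (Icc a b))
    (hη' : ContinuousOn η' (Icc a b)) (hζ' : ContinuousOn ζ' (Icc a b))
    (dη : ∀ s ∈ Ioo a b, HasDerivAt η (η' s) s) (dζ : ∀ s ∈ Ioo a b, HasDerivAt ζ (ζ' s) s)
    (hα : 0 < α) (hβ : 0 < β) (hp : 0 ≤ p) (hr : 0 ≤ r) (hc : 0 < c) (hd : 0 ≤ d)
    (hE : ∀ s ∈ Icc a b, inner ℝ (η' s) (ζ s) + inner ℝ (η s) (ζ' s)
      ≤ -(α * ‖η s‖ ^ 2 + β * ‖ζ s‖ ^ 2))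
    (hN : ∀ s ∈ Icc a b, ‖ζ' s‖ ≤ p * ‖ζ s‖ + r * ‖η s‖)
    (hb₁ : c * ‖η b‖ ^ 2 ≤ inner ℝ (η b) (ζ b)) (hb₂ : ‖ζ b‖ ≤ d * ‖η b‖) :
    c * ‖η b‖ ^ 2 + (∫ s in a..b, (α * ‖η s‖ ^ 2 + β * ‖ζ s‖ ^ 2)) ≤ inner ℝ (η a) (ζ a) ∧
      ‖ζ a‖ ≤ (d ^ 2 / c + (p ^ 2 / β + r ^ 2 / α) * (b - a)) * ‖η a‖ := by
  set Q : ℝ := ∫ s in a..b, (α * ‖η s‖ ^ 2 + β * ‖ζ s‖ ^ 2) with hQ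
  have cQ : ContinuousOn (fun s => α * ‖η s‖ ^ 2 + β * ‖ζ s‖ ^ 2) (Icc a b) := by fun_prop
  have hQ0 : 0 ≤ Q := intervalIntegral.integral_nonneg hab fun s _ => by positivity
  have cE : ContinuousOn (fun s => inner ℝ (η s) (ζ' s) + inner ℝ (η' s) (ζ s)) (Icc a b) := by
    fun_prop
  have hEint : c * ‖η b‖ ^ 2 + Q ≤ inner ℝ (η a) (ζ a) := by
    have h1 := intervalIntegral.integral_eq_sub_of_hasDerivAt_of_le hab
      (f := fun s => inner ℝ (η s) (ζ s)) (by fun_prop)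
      (fun s hs => (dη s hs).inner ℝ (dζ s hs)) (cE.intervalIntegrable_of_Icc hab)
    have h2 := intervalIntegral.integral_mono_on (μ := volume) hab (cE.intervalIntegrable_of_Icc hab)
      (cQ.neg.intervalIntegrable_of_Icc hab)
      (fun s hs => by have := hE s hs; simp only [Pi.neg_apply] at *; linarith)
    have h3 : ∫ s in a..b, (-fun s => α * ‖η s‖ ^ 2 + β * ‖ζ s‖ ^ 2) s = -Q := by
      simp only [Pi.neg_apply]
      rw [intervalIntegral.integral_neg]
    rw [h3] at h2
    linarith
  refine ⟨hEint, ?_⟩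
  set g : ℝ → ℝ := fun s => p * ‖ζ s‖ + r * ‖η s‖ with hg
  have cg : ContinuousOn g (Icc a b) := by fun_prop
  set D : ℝ := p ^ 2 / β + r ^ 2 / α with hD
  have hD0 : 0 ≤ D := by positivity
  have hI : ‖ζ a‖ ≤ d * ‖η b‖ + ∫ s in a..b, g s := by
    have h1 := intervalIntegral.integral_eq_sub_of_hasDerivAt_of_le hab hζ dζ
      (hζ'.intervalIntegrable_of_Icc hab)
    have h2 := intervalIntegral.norm_integral_le_of_norm_le hab (μ := volume) (f := ζ') (g := g)
      (Filter.Eventually.of_forall fun s hs => hN s (Ioc_subset_Icc_self hs))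
      (cg.intervalIntegrable_of_Icc hab)
    rw [h1] at h2
    have h3 : ‖ζ a‖ ≤ ‖ζ b‖ + ‖ζ b - ζ a‖ := by
      have := norm_sub_le (ζ b) (ζ b - ζ a)
      simpa using this
    linarith
  have hg2 : (∫ s in a..b, g s) ^ 2 ≤ (b - a) * (D * Q) := by
    refine (sq_integral_le_mul_integral_sq hab cg).trans ?_
    refine mul_le_mul_of_nonneg_left ?_ (sub_nonneg.2 hab)
    rw [hQ, ← intervalIntegral.integral_const_mul]
    refine intervalIntegral.integral_mono_on hab ((cg.pow 2).intervalIntegrable_of_Icc hab)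
      ((continuousOn_const.mul cQ).intervalIntegrable_of_Icc hab) fun s _ => ?_
    -- Weighted Cauchy–Schwarz: the defect is a perfect square, which dictates the choice of `D`.
    have : D * (α * ‖η s‖ ^ 2 + β * ‖ζ s‖ ^ 2) - g s ^ 2
        = (p * α * ‖η s‖ - r * β * ‖ζ s‖) ^ 2 / (α * β) := by
      rw [hD, hg]; field_simp; ring
    have h0 : 0 ≤ (p * α * ‖η s‖ - r * β * ‖ζ s‖) ^ 2 / (α * β) := by positivity
    linarith
  have hG0 : 0 ≤ ∫ s in a..b, g s :=
    intervalIntegral.integral_nonneg hab fun s _ => by positivity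
  set G : ℝ := ∫ s in a..b, g s
  have hx0 : 0 ≤ d ^ 2 / c := by positivity
  have hy0 : 0 ≤ D * (b - a) := mul_nonneg hD0 (sub_nonneg.2 hab)
  have hX : (d * ‖η b‖) ^ 2 = d ^ 2 / c * (c * ‖η b‖ ^ 2) := by field_simp
  have hsq : ‖ζ a‖ ^ 2 ≤ (d ^ 2 / c + D * (b - a)) * (c * ‖η b‖ ^ 2 + Q) := by
    set X := c * ‖η b‖ ^ 2
    have hX0 : 0 ≤ X := by positivity
    set u := d * ‖η b‖
    have hu0 : 0 ≤ u := by positivity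
    set x := d ^ 2 / c
    set y := D * (b - a)
    have hG : G ^ 2 ≤ y * Q := by simp only [y]; linarith
    have h1 : ‖ζ a‖ ^ 2 ≤ (u + G) ^ 2 := pow_le_pow_left₀ (norm_nonneg _) hI 2
    -- Arithmetic-geometric mean inequality, from `u² = x X` and `G² ≤ y Q`.
    have h2 : 2 * u * G ≤ x * Q + y * X := by
      refine abs_le_of_sq_le_sq' ?_ (by positivity) |>.2
      have h3 : (2 * u * G) ^ 2 ≤ 4 * (x * X) * (y * Q) := by
        have : (2 * u * G) ^ 2 = 4 * u ^ 2 * G ^ 2 := by ring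
        rw [this, hX]
        gcongr
      nlinarith [sq_nonneg (x * Q - y * X)]
    nlinarith
  -- The energy is at most `‖η a‖ ‖ζ a‖`, so one factor `‖ζ a‖` cancels.
  have hfin : ‖ζ a‖ ^ 2 ≤ ((d ^ 2 / c + D * (b - a)) * ‖η a‖) * ‖ζ a‖ := by
    refine hsq.trans ?_
    rw [mul_assoc]
    refine mul_le_mul_of_nonneg_left (hEint.trans ?_) (by positivity)
    exact real_inner_le_norm _ _
  rcases (norm_nonneg (ζ a)).eq_or_lt with h | h
  · rw [← h]; positivity
  · rw [sq] at hfin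
    exact le_of_mul_le_mul_right hfin h

/-- The increment is at most a quarter of the maximum of `‖η‖`, so that maximum is at most `4/3 ‖η
b‖`. This supplies the contraction factor in the existence proof. -/
theorem norm_sub_le_half_of_norm_deriv_le {η η' : ℝ → H} {a b K : ℝ} (hab : a ≤ b)
    (hη : ContinuousOn η (Icc a b)) (hη' : ContinuousOn η' (Icc a b))
    (dη : ∀ s ∈ Ioo a b, HasDerivAt η (η' s) s) (hK : 0 ≤ K)
    (hN : ∀ s ∈ Icc a b, ‖η' s‖ ≤ K * ‖η s‖) (hs : (b - a) * K ≤ 1 / 4) :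
    ‖η a - η b‖ ≤ 1 / 2 * ‖η b‖ := by
  obtain ⟨s₀, hs₀, hmax⟩ := isCompact_Icc.exists_isMaxOn (nonempty_Icc.2 hab) hη.norm
  have key : ∀ s ∈ Icc a b, ‖η s - η b‖ ≤ 1 / 4 * ‖η s₀‖ := by
    intro s hs'
    have hsub : Icc s b ⊆ Icc a b := Icc_subset_Icc_left hs'.1
    have h1 := intervalIntegral.integral_eq_sub_of_hasDerivAt_of_le hs'.2 (hη.mono hsub)
      (fun r hr => dη r ⟨hs'.1.trans_lt hr.1, hr.2⟩)
      ((hη'.mono hsub).intervalIntegrable_of_Icc hs'.2)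
    have h2 := intervalIntegral.norm_integral_le_of_norm_le_const (a := s) (b := b) (f := η')
      (C := K * ‖η s₀‖) (fun r hr => by
        rw [uIoc_of_le hs'.2] at hr
        have hr' := hsub (Ioc_subset_Icc_self hr)
        exact (hN r hr').trans (mul_le_mul_of_nonneg_left (hmax hr') hK))
    rw [h1, abs_of_nonneg (sub_nonneg.2 hs'.2), norm_sub_rev] at h2
    refine h2.trans ?_
    have : (b - s) * K ≤ 1 / 4 := (mul_le_mul_of_nonneg_right (by linarith [hs'.1]) hK).trans hs
    nlinarith [norm_nonneg (η s₀)]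
  have h1 := key s₀ hs₀
  have h2 := key a (left_mem_Icc.2 hab)
  have h3 : ‖η s₀‖ ≤ ‖η s₀ - η b‖ + ‖η b‖ := by
    simpa using norm_add_le (η s₀ - η b) (η b)
  linarith [norm_nonneg (η b)]

end Energy

end HilbertControl

/-! ### Hessian bounds and strong convexity. -/

namespace HilbertControl

/-- Cauchy–Schwarz for the semidefinite form `(S ξ, η)`, applied to `ξ` and `S ξ`; it comes from the
discriminant of the form at `r • ξ + S ξ`. -/
theorem norm_le_of_symmetric_of_inner_le {H : Type*} [NormedAddCommGroup H]
    [InnerProductSpace ℝ H] {S : H →L[ℝ] H} {M : ℝ} (hM : 0 ≤ M)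
    (hsymm : ∀ ξ η, inner ℝ (S ξ) η = inner ℝ (S η) ξ) (h0 : ∀ ξ, 0 ≤ inner ℝ (S ξ) ξ)
    (h1 : ∀ ξ, inner ℝ (S ξ) ξ ≤ M * ‖ξ‖ ^ 2) : ‖S‖ ≤ M := by
  refine S.opNorm_le_bound hM fun ξ => ?_
  have key : inner ℝ (S ξ) (S ξ) ^ 2 ≤ inner ℝ (S ξ) ξ * inner ℝ (S (S ξ)) (S ξ) := by
    have hq : ∀ r : ℝ, 0 ≤ inner ℝ (S ξ) ξ * (r * r) + (2 * inner ℝ (S ξ) (S ξ)) * r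
        + inner ℝ (S (S ξ)) (S ξ) := by
      intro r
      have := h0 (r • ξ + S ξ)
      rw [map_add, map_smul] at this
      simp only [inner_add_left, inner_add_right, real_inner_smul_left, real_inner_smul_right,
        hsymm (S ξ) ξ] at this
      linarith
    have := discrim_le_zero hq
    rw [discrim] at this
    nlinarith
  rw [real_inner_self_eq_norm_sq] at key
  have h2 := mul_le_mul (h1 ξ) (h1 (S ξ)) (h0 _) (by positivity)
  have h3 : ‖S ξ‖ ^ 2 * ‖S ξ‖ ^ 2 ≤ (M * ‖ξ‖) ^ 2 * ‖S ξ‖ ^ 2 := by nlinarith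
  rcases (norm_nonneg (S ξ)).eq_or_lt with h | h
  · rw [← h]; positivity
  · exact abs_le_of_sq_le_sq' (le_of_mul_le_mul_right h3 (by positivity)) (by positivity) |>.2

section Convex

variable {H : Type*} [NormedAddCommGroup H] [InnerProductSpace ℝ H] [CompleteSpace H]

theorem contDiff_gradient {f : H → ℝ} (hf : ContDiff ℝ 2 f) : ContDiff ℝ 1 (gradient f) :=
  ((InnerProductSpace.toDual ℝ H).symm : StrongDual ℝ H ≃L⋆[ℝ] H).toContinuousLinearMap.contDiff.comp
    (hf.fderiv_right (by norm_num))

theorem inner_fderiv_gradient {f : H → ℝ} (hf : ContDiff ℝ 2 f) (x ξ η : H) :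
    inner ℝ (fderiv ℝ (gradient f) x ξ) η = fderiv ℝ (fderiv ℝ f) x ξ η := by
  have h1 : Differentiable ℝ (gradient f) := (contDiff_gradient hf).differentiable one_ne_zero
  have h2 : Differentiable ℝ (fderiv ℝ f) :=
    (hf.fderiv_right (m := 1) (by norm_num)).differentiable one_ne_zero
  have e1 : HasFDerivAt (fun y => inner ℝ (gradient f y) η) _ x :=
    (h1 x).hasFDerivAt.inner ℝ (hasFDerivAt_const η x)
  have e2 : HasFDerivAt (fun y => fderiv ℝ f y η) _ x :=
    (h2 x).hasFDerivAt.clm_apply (hasFDerivAt_const η x)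
  have e3 : (fun y => inner ℝ (gradient f y) η) = fun y => fderiv ℝ f y η := by
    ext y
    simp [gradient]
  rw [e3] at e1
  have := congrArg (fun L => L ξ) (e1.unique e2)
  simpa using this

theorem inner_fderiv_gradient_comm {f : H → ℝ} (hf : ContDiff ℝ 2 f) (x ξ η : H) :
    inner ℝ (fderiv ℝ (gradient f) x ξ) η = inner ℝ (fderiv ℝ (gradient f) x η) ξ := by
  rw [inner_fderiv_gradient hf, inner_fderiv_gradient hf]
  exact (hf.contDiffAt.isSymmSndFDerivAt (by simp)) ξ η

variable {f : H → ℝ} {ν M : ℝ}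

theorem norm_gradient_sub_le (hf : ContDiff ℝ 2 f) (hν : 0 < ν) (hM : 0 ≤ M)
    (h₁ : ∀ x ξ, ν * ‖ξ‖ ^ 2 ≤ inner ℝ (fderiv ℝ (gradient f) x ξ) ξ)
    (h₂ : ∀ x ξ, inner ℝ (fderiv ℝ (gradient f) x ξ) ξ ≤ M * ‖ξ‖ ^ 2) (x y : H) :
    ‖gradient f x - gradient f y‖ ≤ M * ‖x - y‖ := by
  have hd : Differentiable ℝ (gradient f) := (contDiff_gradient hf).differentiable one_ne_zero
  exact convex_univ.norm_image_sub_le_of_norm_fderiv_le (fun z _ => hd z)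
    (fun z _ => norm_le_of_symmetric_of_inner_le hM (inner_fderiv_gradient_comm hf z)
      (fun ξ => le_trans (by positivity) (h₁ z ξ)) (h₂ z)) (mem_univ y) (mem_univ x)

theorem inner_gradient_sub_ge (hf : ContDiff ℝ 2 f)
    (h₁ : ∀ x ξ, ν * ‖ξ‖ ^ 2 ≤ inner ℝ (fderiv ℝ (gradient f) x ξ) ξ) (x y : H) :
    ν * ‖x - y‖ ^ 2 ≤ inner ℝ (gradient f x - gradient f y) (x - y) := by
  have hd : Differentiable ℝ (gradient f) := (contDiff_gradient hf).differentiable one_ne_zero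
  have hφ : ∀ θ : ℝ, HasDerivAt (fun θ : ℝ => inner ℝ (gradient f (y + θ • (x - y))) (x - y)
      - θ * (ν * ‖x - y‖ ^ 2))
      (inner ℝ (fderiv ℝ (gradient f) (y + θ • (x - y)) (x - y)) (x - y)
        - ν * ‖x - y‖ ^ 2) θ := by
    intro θ
    have h1 : HasDerivAt (fun θ : ℝ => y + θ • (x - y)) (x - y) θ := by
      simpa using ((hasDerivAt_id θ).smul_const (x - y)).const_add y
    have h2 := ((hd _).hasFDerivAt.comp_hasDerivAt θ h1).inner ℝ (hasDerivAt_const θ (x - y))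
    have h3 := (hasDerivAt_id θ).mul_const (ν * ‖x - y‖ ^ 2)
    simpa using! h2.sub h3
  have hm := monotone_of_hasDerivAt_nonneg hφ fun θ => sub_nonneg.2 (h₁ _ _)
  have := hm zero_le_one
  simp only [zero_smul, add_zero, one_smul, add_sub_cancel, zero_mul, sub_zero, one_mul] at this
  rw [inner_sub_left]
  linarith

/-- Along the segment from `y` to `x`, the derivative of the defect is nonnegative by strong
monotonicity of the gradient. -/
theorem add_sq_le_sub_inner_gradient (hf : ContDiff ℝ 2 f)
    (h₁ : ∀ x ξ, ν * ‖ξ‖ ^ 2 ≤ inner ℝ (fderiv ℝ (gradient f) x ξ) ξ) (x y : H) :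
    ν / 2 * ‖x - y‖ ^ 2 ≤ f x - f y - inner ℝ (gradient f y) (x - y) := by
  have hd : Differentiable ℝ f := hf.differentiable two_ne_zero
  have hφ : ∀ θ : ℝ, HasDerivAt (fun θ : ℝ => f (y + θ • (x - y))
      - θ * inner ℝ (gradient f y) (x - y) - θ ^ 2 * (ν / 2 * ‖x - y‖ ^ 2))
      (inner ℝ (gradient f (y + θ • (x - y))) (x - y) - inner ℝ (gradient f y) (x - y)
        - 2 * θ * (ν / 2 * ‖x - y‖ ^ 2)) θ := by
    intro θ
    have h1 : HasDerivAt (fun θ : ℝ => y + θ • (x - y)) (x - y) θ := by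
      simpa using ((hasDerivAt_id θ).smul_const (x - y)).const_add y
    have h2 := (hd _).hasGradientAt.hasFDerivAt.comp_hasDerivAt θ h1
    have h3 := (hasDerivAt_id θ).mul_const (inner ℝ (gradient f y) (x - y))
    have h4 := ((hasDerivAt_id θ).pow 2).mul_const (ν / 2 * ‖x - y‖ ^ 2)
    simpa using! (h2.sub h3).sub h4
  have hm : MonotoneOn (fun θ : ℝ => f (y + θ • (x - y))
      - θ * inner ℝ (gradient f y) (x - y) - θ ^ 2 * (ν / 2 * ‖x - y‖ ^ 2)) (Icc 0 1) := by
    refine monotoneOn_of_hasDerivWithinAt_nonneg (convex_Icc 0 1)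
      (fun θ _ => (hφ θ).continuousAt.continuousWithinAt)
      (fun θ _ => (hφ θ).hasDerivWithinAt) fun θ hθ => ?_
    rw [interior_Icc] at hθ
    have := inner_gradient_sub_ge hf h₁ (y + θ • (x - y)) y
    rw [add_sub_cancel_left, norm_smul, real_inner_smul_right, inner_sub_left, Real.norm_eq_abs,
      abs_of_pos hθ.1] at this
    have h5 : θ * (ν * θ * ‖x - y‖ ^ 2) ≤ θ * (inner ℝ (gradient f (y + θ • (x - y))) (x - y)
      - inner ℝ (gradient f y) (x - y)) := by linarith
    have := le_of_mul_le_mul_left h5 hθ.1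
    linarith
  have := hm (left_mem_Icc.2 zero_le_one) (right_mem_Icc.2 zero_le_one) zero_le_one
  simp only [zero_smul, add_zero, one_smul, add_sub_cancel, zero_mul, sub_zero, one_mul,
    one_pow, ne_eq, OfNat.ofNat_ne_zero, not_false_eq_true, zero_pow] at this
  linarith

end Convex

/-! ### Consequences of the standing assumptions. -/

namespace Problem

variable {H U : Type*}
  [NormedAddCommGroup H] [InnerProductSpace ℝ H] [CompleteSpace H]
  [NormedAddCommGroup U] [InnerProductSpace ℝ U] [CompleteSpace U]

namespace Assumptions

variable {P : Problem H U} {γ b ν M νT MT m k : ℝ} (hP : P.Assumptions γ b ν M νT MT m k)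

include hP

theorem γ_nonneg : 0 ≤ γ := (norm_nonneg _).trans (hP.A_bound 0)

/-- On the zero space `γ_small` would read `γ² < 0`. A nonzero vector is what fixes the signs of
`b`, `M` and `MT`. -/
theorem nontrivial : Nontrivial H := by
  by_contra h
  rw [not_nontrivial_iff_subsingleton] at h
  have h1 : P.BNB = 0 := by ext x; exact Subsingleton.elim _ _
  have := hP.γ_small
  rw [h1, norm_zero, mul_zero] at this
  nlinarith [sq_nonneg γ]

theorem b_nonneg : 0 ≤ b := by
  obtain ⟨x, hx⟩ := haveI := hP.nontrivial; exists_ne (0 : H)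
  have h := (norm_nonneg _).trans (hP.A_lip x 0)
  by_contra hb
  have hx' : 0 < ‖x - 0‖ := by simpa using hx
  have hden : 0 < 1 + max ‖x‖ ‖(0 : H)‖ := by positivity
  have : b * ‖x - 0‖ / (1 + max ‖x‖ ‖(0 : H)‖) < 0 :=
    div_neg_of_neg_of_pos (mul_neg_of_neg_of_pos (not_le.1 hb) hx') hden
  linarith

theorem M_pos : 0 < M := by
  obtain ⟨x, hx⟩ := haveI := hP.nontrivial; exists_ne (0 : H)
  have h := (hP.F_lower 0 x).trans (hP.F_upper 0 x)
  exact hP.ν_pos.trans_le (le_of_mul_le_mul_right h (by positivity))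

theorem MT_pos : 0 < MT := by
  obtain ⟨x, hx⟩ := haveI := hP.nontrivial; exists_ne (0 : H)
  have h := (hP.FT_lower 0 x).trans (hP.FT_upper 0 x)
  exact hP.νT_pos.trans_le (le_of_mul_le_mul_right h (by positivity))

theorem differentiable_A : Differentiable ℝ P.A := hP.A_C1.differentiable one_ne_zero

theorem norm_A_sub_le (x y : H) : ‖P.A x - P.A y‖ ≤ γ * ‖x - y‖ :=
  convex_univ.norm_image_sub_le_of_norm_fderiv_le (fun z _ => hP.differentiable_A z)
    (fun z _ => hP.A_bound z) (mem_univ y) (mem_univ x)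

/-- The quadratic remainder of the first order expansion of the drift. -/
theorem norm_A_remainder_le (x y : H) :
    ‖P.A x - P.A y - fderiv ℝ P.A y (x - y)‖ ≤ b / 2 * ‖x - y‖ ^ 2 / (1 + ‖y‖) := by
  set c : ℝ := b / 2 * ‖x - y‖ ^ 2 / (1 + ‖y‖) with hc
  have hφ : ∀ θ : ℝ, HasDerivAt (fun θ : ℝ => P.A (y + θ • (x - y)) - P.A y
      - θ • fderiv ℝ P.A y (x - y))
      (fderiv ℝ P.A (y + θ • (x - y)) (x - y) - fderiv ℝ P.A y (x - y)) θ := by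
    intro θ
    have h1 : HasDerivAt (fun θ : ℝ => y + θ • (x - y)) (x - y) θ := by
      simpa using ((hasDerivAt_id θ).smul_const (x - y)).const_add y
    have h2 := (hP.differentiable_A _).hasFDerivAt.comp_hasDerivAt θ h1
    have h3 := (hasDerivAt_id θ).smul_const (fderiv ℝ P.A y (x - y))
    simpa using! (h2.sub_const (P.A y)).sub h3
  have hB : ∀ θ : ℝ, HasDerivAt (fun θ : ℝ => θ ^ 2 * c) (2 * θ * c) θ := fun θ => by
    simpa using! ((hasDerivAt_id θ).pow 2).mul_const c
  have := image_norm_le_of_norm_deriv_right_le_deriv_boundary (a := 0) (b := 1)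
    (fun θ _ => (hφ θ).continuousAt.continuousWithinAt) (fun θ _ => (hφ θ).hasDerivWithinAt)
    (by simp) hB (fun θ hθ => by
      rw [← _root_.sub_apply]
      refine (ContinuousLinearMap.le_opNorm _ _).trans ?_
      have h1 := hP.A_lip (y + θ • (x - y)) y
      rw [add_sub_cancel_left, norm_smul, Real.norm_eq_abs, abs_of_nonneg hθ.1] at h1
      have h2 : b * (θ * ‖x - y‖) / (1 + max ‖y + θ • (x - y)‖ ‖y‖)
          ≤ b * (θ * ‖x - y‖) / (1 + ‖y‖) := by
        have := hP.b_nonneg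
        have := hθ.1
        gcongr
        exact le_max_right _ _
      calc _ ≤ b * (θ * ‖x - y‖) / (1 + ‖y‖) * ‖x - y‖ := by
            gcongr; exact h1.trans h2
        _ = 2 * θ * c := by rw [hc]; ring) (right_mem_Icc.2 zero_le_one)
  simpa using this

/-- Expand about `y` and evaluate at `0`, where `A` vanishes; the weight turns `‖y‖²` into `‖y‖`. -/
theorem norm_A_sub_fderiv_le (y : H) : ‖P.A y - fderiv ℝ P.A y y‖ ≤ b / 2 * ‖y‖ := by
  have h := hP.norm_A_remainder_le 0 y
  rw [hP.A_zero, zero_sub, zero_sub, map_neg, norm_neg, sub_neg_eq_add, neg_add_eq_sub,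
    norm_sub_rev] at h
  refine h.trans ?_
  rw [div_le_iff₀ (by positivity)]
  nlinarith [hP.b_nonneg, norm_nonneg y, mul_nonneg hP.b_nonneg (norm_nonneg y)]

theorem norm_gradF_sub_le (x y : H) : ‖gradient P.F x - gradient P.F y‖ ≤ M * ‖x - y‖ :=
  norm_gradient_sub_le hP.F_C2 hP.ν_pos hP.M_pos.le hP.F_lower hP.F_upper x y

theorem norm_gradFT_sub_le (x y : H) : ‖gradient P.FT x - gradient P.FT y‖ ≤ MT * ‖x - y‖ :=
  norm_gradient_sub_le hP.FT_C2 hP.νT_pos hP.MT_pos.le hP.FT_lower hP.FT_upper x y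

theorem inner_gradF_sub_ge (x y : H) :
    ν * ‖x - y‖ ^ 2 ≤ inner ℝ (gradient P.F x - gradient P.F y) (x - y) :=
  inner_gradient_sub_ge hP.F_C2 hP.F_lower x y

theorem inner_gradFT_sub_ge (x y : H) :
    νT * ‖x - y‖ ^ 2 ≤ inner ℝ (gradient P.FT x - gradient P.FT y) (x - y) :=
  inner_gradient_sub_ge hP.FT_C2 hP.FT_lower x y

theorem norm_gradFT_le (y : H) : ‖gradient P.FT y‖ ≤ MT * ‖y‖ := by
  simpa [hP.DFT_zero] using hP.norm_gradFT_sub_le y 0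

theorem inner_gradF_ge (y : H) : ν * ‖y‖ ^ 2 ≤ inner ℝ (gradient P.F y) y := by
  simpa [hP.DF_zero] using hP.inner_gradF_sub_ge y 0

theorem inner_gradFT_ge (y : H) : νT * ‖y‖ ^ 2 ≤ inner ℝ (gradient P.FT y) y := by
  simpa [hP.DFT_zero] using hP.inner_gradFT_sub_ge y 0

theorem continuous_A : Continuous P.A := hP.A_C1.continuous

theorem continuous_fderiv_A : Continuous (fderiv ℝ P.A) := hP.A_C1.continuous_fderiv one_ne_zero

theorem continuous_gradF : Continuous (gradient P.F) := (contDiff_gradient hP.F_C2).continuous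

end Assumptions

end Problem

end HilbertControl

/-! ### A priori estimates and uniqueness for the forward-backward system. -/

namespace HilbertControl

namespace Problem

variable {H U : Type*}
  [NormedAddCommGroup H] [InnerProductSpace ℝ H] [CompleteSpace H]
  [NormedAddCommGroup U] [InnerProductSpace ℝ U] [CompleteSpace U]

/-- The right-hand side of the forward equation. -/
noncomputable def stateField (P : Problem H U) (y z : H) : H := P.A y - P.BNB z

/-- The right-hand side of the backward equation. -/
noncomputable def costateField (P : Problem H U) (y z : H) : H :=
  -(ContinuousLinearMap.adjoint (fderiv ℝ P.A y) z + gradient P.F y)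

/-- Any later time can serve as initial time, so estimates at `t` propagate to all of `[t, T]`. -/
theorem IsFBSolution.restrict {P : Problem H U} {x : H} {t s : ℝ} {y z : ℝ → H}
    (h : P.IsFBSolution x t y z) (hs : t ≤ s) : P.IsFBSolution (y s) s y z where
  y_cont := h.y_cont.mono (Icc_subset_Icc_left hs)
  z_cont := h.z_cont.mono (Icc_subset_Icc_left hs)
  forward r hr := h.forward r ⟨hs.trans_lt hr.1, hr.2⟩
  backward r hr := h.backward r ⟨hs.trans_lt hr.1, hr.2⟩
  initial := rfl
  terminal := h.terminal

/-- The constant in the growth estimate `‖z‖ ≤ C ‖y‖` for the forward-backward system. -/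
noncomputable def growthConst (γ M νT MT k T : ℝ) : ℝ := MT ^ 2 / νT + (γ ^ 2 + M ^ 2) / k * T

/-- The Lipschitz constant of the decoupling function, in terms of the growth constant `C`. -/
noncomputable def lipConst (γ b ν M νT MT m T C : ℝ) : ℝ :=
  MT ^ 2 / νT + (γ ^ 2 / m + (M + b * C) ^ 2 / (ν - b * C)) * T

namespace Assumptions

variable {P : Problem H U} {γ b ν M νT MT m k : ℝ} (hP : P.Assumptions γ b ν M νT MT m k)

include hP

theorem continuousOn_stateField {y z : ℝ → H} {S : Set ℝ} (hy : ContinuousOn y S)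
    (hz : ContinuousOn z S) : ContinuousOn (fun s => P.stateField (y s) (z s)) S :=
  (hP.continuous_A.comp_continuousOn hy).sub (P.BNB.continuous.comp_continuousOn hz)

theorem continuousOn_costateField {y z : ℝ → H} {S : Set ℝ} (hy : ContinuousOn y S)
    (hz : ContinuousOn z S) : ContinuousOn (fun s => P.costateField (y s) (z s)) S := by
  have h1 : ContinuousOn (fun s => ContinuousLinearMap.adjoint (fderiv ℝ P.A (y s))) S :=
    (ContinuousLinearMap.adjoint (𝕜 := ℝ) (E := H) (F := H)).continuous.comp_continuousOn
      (hP.continuous_fderiv_A.comp_continuousOn hy)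
  exact ((h1.clm_apply hz).add (hP.continuous_gradF.comp_continuousOn hy)).neg

theorem growthConst_nonneg : 0 ≤ growthConst γ M νT MT k P.T := by
  have := hP.νT_pos
  have := hP.k_pos
  have := hP.T_pos
  unfold growthConst
  positivity

theorem sub_growthConst_pos : 0 < ν - b * growthConst γ M νT MT k P.T := hP.b_small'

theorem lipConst_nonneg :
    0 ≤ lipConst γ b ν M νT MT m P.T (growthConst γ M νT MT k P.T) := by
  have := hP.νT_pos
  have := hP.m_pos
  have := hP.T_pos
  have := hP.sub_growthConst_pos
  unfold lipConst
  positivity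

theorem norm_adjoint_apply_le (y z : H) :
    ‖ContinuousLinearMap.adjoint (fderiv ℝ P.A y) z‖ ≤ γ * ‖z‖ := by
  refine (ContinuousLinearMap.le_opNorm _ _).trans ?_
  rw [LinearIsometryEquiv.norm_map]
  exact mul_le_mul_of_nonneg_right (hP.A_bound y) (norm_nonneg z)

theorem norm_stateField_sub_le (y₁ y₂ z₁ z₂ : H) :
    ‖P.stateField y₁ z₁ - P.stateField y₂ z₂‖ ≤ γ * ‖y₁ - y₂‖ + ‖P.BNB‖ * ‖z₁ - z₂‖ := by
  have : P.stateField y₁ z₁ - P.stateField y₂ z₂ = P.A y₁ - P.A y₂ - P.BNB (z₁ - z₂) := by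
    rw [stateField, stateField, map_sub]; abel
  rw [this]
  exact (norm_sub_le _ _).trans (add_le_add (hP.norm_A_sub_le _ _) (P.BNB.le_opNorm _))

theorem norm_costateField_sub_le (y₁ y₂ z₁ z₂ : H) :
    ‖P.costateField y₁ z₁ - P.costateField y₂ z₂‖ ≤ γ * ‖z₁ - z₂‖
      + (M + b * ‖z₂‖ / (1 + max ‖y₁‖ ‖y₂‖)) * ‖y₁ - y₂‖ := by
  have : P.costateField y₁ z₁ - P.costateField y₂ z₂
      = -(ContinuousLinearMap.adjoint (fderiv ℝ P.A y₁) (z₁ - z₂)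
        + ContinuousLinearMap.adjoint (fderiv ℝ P.A y₁ - fderiv ℝ P.A y₂) z₂
        + (gradient P.F y₁ - gradient P.F y₂)) := by
    rw [costateField, costateField, map_sub, map_sub, _root_.sub_apply]; abel
  rw [this, norm_neg]
  have h1 := hP.norm_adjoint_apply_le y₁ (z₁ - z₂)
  have h2 : ‖ContinuousLinearMap.adjoint (fderiv ℝ P.A y₁ - fderiv ℝ P.A y₂) z₂‖
      ≤ b * ‖z₂‖ / (1 + max ‖y₁‖ ‖y₂‖) * ‖y₁ - y₂‖ := by
    refine (ContinuousLinearMap.le_opNorm _ _).trans ?_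
    rw [LinearIsometryEquiv.norm_map]
    refine (mul_le_mul_of_nonneg_right (hP.A_lip y₁ y₂) (norm_nonneg z₂)).trans (le_of_eq ?_)
    ring
  have h3 := hP.norm_gradF_sub_le y₁ y₂
  refine (norm_add₃_le).trans ?_
  linarith

theorem norm_costateField_le (y z : H) : ‖P.costateField y z‖ ≤ γ * ‖z‖ + M * ‖y‖ := by
  have h : P.costateField 0 0 = 0 := by simp [costateField, hP.DF_zero]
  simpa [h] using hP.norm_costateField_sub_le y 0 z 0

/-- The growth of `z` is compensated by the weight `1 / (1 + ‖y‖)` of the remainder. -/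
theorem abs_inner_A_remainder_le {x y z : H} {C : ℝ} (hC : 0 ≤ C) (hz : ‖z‖ ≤ C * ‖y‖) :
    |inner ℝ (P.A x - P.A y - fderiv ℝ P.A y (x - y)) z| ≤ b * C / 2 * ‖x - y‖ ^ 2 := by
  refine (abs_real_inner_le_norm _ _).trans ?_
  have hb := hP.b_nonneg
  have h1 := mul_le_mul (hP.norm_A_remainder_le x y) hz (norm_nonneg _) (by positivity)
  refine h1.trans ?_
  rw [div_mul_eq_mul_div, div_le_iff₀ (by positivity)]
  have : 0 ≤ b * C / 2 * ‖x - y‖ ^ 2 := by positivity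
  nlinarith

theorem inner_field_le (y z : H) :
    inner ℝ (P.stateField y z) z + inner ℝ y (P.costateField y z)
      ≤ -(k * ‖y‖ ^ 2 + k * ‖z‖ ^ 2) := by
  have h1 : inner ℝ (P.stateField y z) z + inner ℝ y (P.costateField y z)
      = inner ℝ (P.A y - fderiv ℝ P.A y y) z - inner ℝ (P.BNB z) z
        - inner ℝ (gradient P.F y) y := by
    rw [stateField, costateField, inner_neg_right, inner_add_right,
      ContinuousLinearMap.adjoint_inner_right, inner_sub_left, inner_sub_left,
      real_inner_comm (gradient P.F y)]
    ring
  have h2 : inner ℝ (P.A y - fderiv ℝ P.A y y) z ≤ b / 2 * ‖y‖ * ‖z‖ :=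
    (real_inner_le_norm _ _).trans
      (mul_le_mul_of_nonneg_right (hP.norm_A_sub_fderiv_le y) (norm_nonneg _))
  have h3 := hP.BNB_lower z
  have h4 := hP.inner_gradF_ge y
  have hp : 0 < ν - k := sub_pos.2 (hP.k_lt.trans_le (min_le_right _ _))
  have h5 : b / 2 * ‖y‖ * ‖z‖ ≤ (ν - k) * ‖y‖ ^ 2 + (m - k) * ‖z‖ ^ 2 := by
    have h6 := hP.b_small
    have h7 : 0 ≤ 4 * (ν - k) * ((ν - k) * ‖y‖ ^ 2 + (m - k) * ‖z‖ ^ 2 - b / 2 * ‖y‖ * ‖z‖) := by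
      -- Completing the square; the leftover coefficient is positive exactly by `b_small`.
      have : 4 * (ν - k) * ((ν - k) * ‖y‖ ^ 2 + (m - k) * ‖z‖ ^ 2 - b / 2 * ‖y‖ * ‖z‖)
          = (2 * (ν - k) * ‖y‖ - b / 2 * ‖z‖) ^ 2
            + 4 * ((m - k) * (ν - k) - b ^ 2 / 16) * ‖z‖ ^ 2 := by ring
      rw [this]
      have : 0 < (m - k) * (ν - k) - b ^ 2 / 16 := sub_pos.2 h6
      positivity
    have := nonneg_of_mul_nonneg_right h7 (by positivity)
    linarith
  rw [h1]
  linarith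

/-- The drift terms regroup into two Taylor remainders, one about each state and paired with the
costate there. Each costs `b C / 2`. -/
theorem inner_field_sub_le {y₁ y₂ z₁ z₂ : H} {C : ℝ} (hC : 0 ≤ C)
    (h₁ : ‖z₁‖ ≤ C * ‖y₁‖) (h₂ : ‖z₂‖ ≤ C * ‖y₂‖) :
    inner ℝ (P.stateField y₁ z₁ - P.stateField y₂ z₂) (z₁ - z₂)
      + inner ℝ (y₁ - y₂) (P.costateField y₁ z₁ - P.costateField y₂ z₂)
      ≤ -((ν - b * C) * ‖y₁ - y₂‖ ^ 2 + m * ‖z₁ - z₂‖ ^ 2) := by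
  have e : inner ℝ (P.stateField y₁ z₁ - P.stateField y₂ z₂) (z₁ - z₂)
      + inner ℝ (y₁ - y₂) (P.costateField y₁ z₁ - P.costateField y₂ z₂)
      = -inner ℝ (P.A y₂ - P.A y₁ - fderiv ℝ P.A y₁ (y₂ - y₁)) z₁
        - inner ℝ (P.A y₁ - P.A y₂ - fderiv ℝ P.A y₂ (y₁ - y₂)) z₂
        - inner ℝ (P.BNB (z₁ - z₂)) (z₁ - z₂)
        - inner ℝ (gradient P.F y₁ - gradient P.F y₂) (y₁ - y₂) := by
    simp only [stateField, costateField, map_sub, inner_sub_left, inner_sub_right,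
      inner_neg_right, inner_add_right, ContinuousLinearMap.adjoint_inner_right]
    rw [real_inner_comm (gradient P.F y₁) y₁, real_inner_comm (gradient P.F y₁) y₂,
      real_inner_comm (gradient P.F y₂) y₁, real_inner_comm (gradient P.F y₂) y₂]
    ring
  have r₁ := neg_le_of_abs_le (hP.abs_inner_A_remainder_le (x := y₂) hC h₁)
  have r₂ := neg_le_of_abs_le (hP.abs_inner_A_remainder_le (x := y₁) hC h₂)
  rw [norm_sub_rev y₂ y₁] at r₁
  have h3 := hP.BNB_lower (z₁ - z₂)
  have h4 := hP.inner_gradF_sub_ge y₁ y₂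
  rw [e]
  linarith

theorem norm_costateField_sub_le' {y₁ y₂ z₁ z₂ : H} {C : ℝ} (hC : 0 ≤ C)
    (h₂ : ‖z₂‖ ≤ C * ‖y₂‖) :
    ‖P.costateField y₁ z₁ - P.costateField y₂ z₂‖
      ≤ γ * ‖z₁ - z₂‖ + (M + b * C) * ‖y₁ - y₂‖ := by
  have hb := hP.b_nonneg
  refine (hP.norm_costateField_sub_le y₁ y₂ z₁ z₂).trans ?_
  have : b * ‖z₂‖ / (1 + max ‖y₁‖ ‖y₂‖) ≤ b * C := by
    rw [div_le_iff₀ (by positivity), mul_assoc]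
    refine mul_le_mul_of_nonneg_left (h₂.trans (mul_le_mul_of_nonneg_left ?_ hC)) hb
    linarith [le_max_right ‖y₁‖ ‖y₂‖]
  gcongr

variable {t : ℝ} {x₁ x₂ : H} {y z y₁ y₂ z₁ z₂ : ℝ → H}

theorem norm_initial_costate_le {x : H} (ht : t ∈ Icc 0 P.T) (h : P.IsFBSolution x t y z) :
    ‖z t‖ ≤ growthConst γ M νT MT k P.T * ‖y t‖ := by
  have hk := hP.k_pos
  have hνT := hP.νT_pos
  have e := (energy_estimate ht.2 h.y_cont h.z_cont
    (hP.continuousOn_stateField h.y_cont h.z_cont)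
    (hP.continuousOn_costateField h.y_cont h.z_cont) h.forward h.backward hk hk
    hP.γ_nonneg hP.M_pos.le hνT hP.MT_pos.le (fun s _ => hP.inner_field_le (y s) (z s))
    (fun s _ => hP.norm_costateField_le (y s) (z s))
    (by rw [h.terminal, real_inner_comm]; exact hP.inner_gradFT_ge _)
    (by rw [h.terminal]; exact hP.norm_gradFT_le _)).2
  refine e.trans (mul_le_mul_of_nonneg_right ?_ (norm_nonneg _))
  rw [growthConst, add_div]
  have : P.T - t ≤ P.T := by linarith [ht.1]
  gcongr

theorem norm_costate_le {x : H} (ht : t ∈ Icc 0 P.T) (h : P.IsFBSolution x t y z) :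
    ∀ s ∈ Icc t P.T, ‖z s‖ ≤ growthConst γ M νT MT k P.T * ‖y s‖ := fun _ hs =>
  hP.norm_initial_costate_le ⟨ht.1.trans hs.1, hs.2⟩ (h.restrict hs.1)

theorem energy_sub (ht : t ∈ Icc 0 P.T) (h₁ : P.IsFBSolution x₁ t y₁ z₁)
    (h₂ : P.IsFBSolution x₂ t y₂ z₂) :
    νT * ‖y₁ P.T - y₂ P.T‖ ^ 2 + (∫ s in t..P.T,
      ((ν - b * growthConst γ M νT MT k P.T) * ‖y₁ s - y₂ s‖ ^ 2 + m * ‖z₁ s - z₂ s‖ ^ 2))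
      ≤ inner ℝ (y₁ t - y₂ t) (z₁ t - z₂ t) ∧
    ‖z₁ t - z₂ t‖ ≤
      lipConst γ b ν M νT MT m P.T (growthConst γ M νT MT k P.T) * ‖y₁ t - y₂ t‖ := by
  have hm := hP.m_pos
  have hνT := hP.νT_pos
  set C := growthConst γ M νT MT k P.T with hCdef
  have hC : 0 ≤ C := hP.growthConst_nonneg
  have hνC : 0 < ν - b * C := hP.sub_growthConst_pos
  have b₁ := hP.norm_costate_le ht h₁
  have b₂ := hP.norm_costate_le ht h₂
  have e := energy_estimate (η := fun s => y₁ s - y₂ s) (ζ := fun s => z₁ s - z₂ s) ht.2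
    (h₁.y_cont.sub h₂.y_cont) (h₁.z_cont.sub h₂.z_cont)
    ((hP.continuousOn_stateField h₁.y_cont h₁.z_cont).sub
      (hP.continuousOn_stateField h₂.y_cont h₂.z_cont))
    ((hP.continuousOn_costateField h₁.y_cont h₁.z_cont).sub
      (hP.continuousOn_costateField h₂.y_cont h₂.z_cont))
    (fun s hs => (h₁.forward s hs).sub (h₂.forward s hs))
    (fun s hs => (h₁.backward s hs).sub (h₂.backward s hs)) hνC hm hP.γ_nonneg
    (add_nonneg hP.M_pos.le (mul_nonneg hP.b_nonneg hC)) hνT hP.MT_pos.le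
    (fun s hs => hP.inner_field_sub_le hC (b₁ s hs) (b₂ s hs))
    (fun s hs => hP.norm_costateField_sub_le' hC (b₂ s hs))
    (by
      simp only [h₁.terminal, h₂.terminal]
      rw [real_inner_comm]
      exact hP.inner_gradFT_sub_ge _ _)
    (by
      simp only [h₁.terminal, h₂.terminal]
      exact hP.norm_gradFT_sub_le _ _)
  refine ⟨e.1, e.2.trans (mul_le_mul_of_nonneg_right ?_ (norm_nonneg _))⟩
  rw [lipConst]
  have : P.T - t ≤ P.T := by linarith [ht.1]
  gcongr

theorem norm_costate_sub_le (ht : t ∈ Icc 0 P.T) (h₁ : P.IsFBSolution x₁ t y₁ z₁)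
    (h₂ : P.IsFBSolution x₂ t y₂ z₂) {s : ℝ} (hs : s ∈ Icc t P.T) :
    ‖z₁ s - z₂ s‖ ≤
      lipConst γ b ν M νT MT m P.T (growthConst γ M νT MT k P.T) * ‖y₁ s - y₂ s‖ :=
  (hP.energy_sub ⟨ht.1.trans hs.1, hs.2⟩ (h₁.restrict hs.1) (h₂.restrict hs.1)).2

/-- With equal initial states the right-hand side of the energy inequality vanishes, which forces
the states to agree; the Lipschitz bound then identifies the costates. -/
theorem eqOn_of_isFBSolution {x : H} (ht : t ∈ Icc 0 P.T) (h₁ : P.IsFBSolution x t y₁ z₁)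
    (h₂ : P.IsFBSolution x t y₂ z₂) :
    EqOn y₁ y₂ (Icc t P.T) ∧ EqOn z₁ z₂ (Icc t P.T) := by
  have hνT := hP.νT_pos
  have hνC := hP.sub_growthConst_pos
  have hm := hP.m_pos
  have hy : EqOn y₁ y₂ (Icc t P.T) := by
    rcases ht.2.eq_or_lt with hT | hT
    · intro s hs
      have : s = t := le_antisymm (hs.2.trans hT.ge) hs.1
      rw [this, h₁.initial, h₂.initial]
    have h := (hP.energy_sub ht h₁ h₂).1
    rw [h₁.initial, h₂.initial, sub_self, inner_zero_left] at h
    by_contra hne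
    obtain ⟨s, hs, hs'⟩ : ∃ s ∈ Icc t P.T, y₁ s ≠ y₂ s := by
      simpa [EqOn, and_assoc] using hne
    have hcy := h₁.y_cont.sub h₂.y_cont
    have hcz := h₁.z_cont.sub h₂.z_cont
    have hpos : 0 < ‖y₁ s - y₂ s‖ := norm_pos_iff.2 (sub_ne_zero.2 hs')
    have := intervalIntegral.integral_pos hT
      (f := fun s => (ν - b * growthConst γ M νT MT k P.T) * ‖y₁ s - y₂ s‖ ^ 2
        + m * ‖z₁ s - z₂ s‖ ^ 2)
      ((continuousOn_const.mul (hcy.norm.pow 2)).add (continuousOn_const.mul (hcz.norm.pow 2)))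
      (fun r _ => by positivity) ⟨s, hs, by positivity⟩
    have : 0 ≤ νT * ‖y₁ P.T - y₂ P.T‖ ^ 2 := by positivity
    linarith
  refine ⟨hy, fun s hs => ?_⟩
  have := hP.norm_costate_sub_le ht h₁ h₂ hs
  rw [hy hs, sub_self, norm_zero, mul_zero] at this
  exact sub_eq_zero.1 (norm_le_zero_iff.1 this)

end Assumptions

end Problem

end HilbertControl

/-! ### Existence by backward continuation. -/

namespace HilbertControl

namespace Problem

variable {H U : Type*}
  [NormedAddCommGroup H] [InnerProductSpace ℝ H] [CompleteSpace H]
  [NormedAddCommGroup U] [InnerProductSpace ℝ U] [CompleteSpace U]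

namespace Assumptions

open Metric NNReal

variable {P : Problem H U} {γ b ν M νT MT m k : ℝ} (hP : P.Assumptions γ b ν M νT MT m k)

include hP

/-- The forward-backward system is solvable with a prescribed terminal state. -/
theorem exists_isFBSolution_of_terminal (q : H) :
    ∃ y z : ℝ → H, P.IsFBSolution (y 0) 0 y z ∧ y P.T = q := by
  have hγ := hP.γ_nonneg
  have hM := hP.M_pos.le
  have hb := hP.b_nonneg
  have hT := hP.T_pos
  -- The time-reversed field, which turns the terminal condition into an initial one.
  set f : H × H → H × H := fun w => (-P.stateField w.1 w.2, -P.costateField w.1 w.2) with hf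
  have hfst : ∀ w : H × H, ‖w.1‖ ≤ ‖w‖ := norm_fst_le
  have hsnd : ∀ w : H × H, ‖w.2‖ ≤ ‖w‖ := norm_snd_le
  have hs0 : P.stateField 0 0 = 0 := by simp [stateField, hP.A_zero]
  have hgrowth : ∀ w, ‖f w‖ ≤ (γ + ‖P.BNB‖ + M) * ‖w‖ := by
    intro w
    have h1 := hP.norm_stateField_sub_le w.1 0 w.2 0
    rw [hs0, sub_zero, sub_zero, sub_zero] at h1
    have h2 := hP.norm_costateField_le w.1 w.2
    have e1 := mul_le_mul_of_nonneg_left (hfst w) hγ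
    have e2 := mul_le_mul_of_nonneg_left (hsnd w) hγ
    have e3 := mul_le_mul_of_nonneg_left (hfst w) hM
    have e4 := mul_le_mul_of_nonneg_left (hsnd w) (norm_nonneg P.BNB)
    have e5 := mul_nonneg hM (norm_nonneg w)
    have e6 := mul_nonneg (norm_nonneg P.BNB) (norm_nonneg w)
    rw [Prod.norm_def]
    refine max_le ?_ ?_
    · rw [norm_neg]; linarith
    · rw [norm_neg]; linarith
  have hlip : ∀ R : ℝ, ∃ L : ℝ≥0, LipschitzOnWith L f (closedBall 0 R) := by
    intro R
    -- The bound on the variation of `DA` is multiplied by the costate, hence the dependence on `R`.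
    have hL : 0 ≤ γ + ‖P.BNB‖ + M + b * |R| := by positivity
    refine ⟨⟨_, hL⟩, LipschitzOnWith.of_dist_le_mul fun w _ w' hw' => ?_⟩
    have hR : ‖w'.2‖ ≤ |R| := (hsnd w').trans ((by simpa using hw' : ‖w'‖ ≤ R).trans (le_abs_self R))
    rw [dist_eq_norm, dist_eq_norm]
    have h1 := hP.norm_stateField_sub_le w.1 w'.1 w.2 w'.2
    have h2 := hP.norm_costateField_sub_le w.1 w'.1 w.2 w'.2
    have h3 : b * ‖w'.2‖ / (1 + max ‖w.1‖ ‖w'.1‖) ≤ b * |R| := by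
      refine (div_le_self (by positivity) ?_).trans (mul_le_mul_of_nonneg_left hR hb)
      linarith [(norm_nonneg _).trans (le_max_left ‖w.1‖ ‖w'.1‖)]
    have d1 : ‖w.1 - w'.1‖ ≤ ‖w - w'‖ := hfst (w - w')
    have d2 : ‖w.2 - w'.2‖ ≤ ‖w - w'‖ := hsnd (w - w')
    have e1 := mul_le_mul_of_nonneg_left d1 hγ
    have e2 := mul_le_mul_of_nonneg_left d2 hγ
    have e3 := mul_le_mul_of_nonneg_left d1 hM
    have e4 := mul_le_mul_of_nonneg_left d2 (norm_nonneg P.BNB)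
    have e5 := mul_nonneg hM (norm_nonneg (w - w'))
    have e6 := mul_nonneg (norm_nonneg P.BNB) (norm_nonneg (w - w'))
    have e7 := mul_le_mul h3 d1 (norm_nonneg _) (by positivity)
    have e8 : 0 ≤ b * |R| * ‖w - w'‖ := by positivity
    change _ ≤ (γ + ‖P.BNB‖ + M + b * |R|) * ‖w - w'‖
    rw [Prod.norm_def]
    refine max_le ?_ ?_
    · rw [Prod.fst_sub, neg_sub_neg, norm_sub_rev]; linarith
    · rw [Prod.snd_sub, neg_sub_neg, norm_sub_rev]; linarith
  obtain ⟨w, hw0, hw⟩ := exists_hasDerivWithinAt_of_linear_growth (T := P.T) (by positivity)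
    hT.le hgrowth hlip (q, gradient P.FT q)
  have hwc : ContinuousOn w (Icc 0 P.T) := fun s hs => (hw s hs).continuousWithinAt
  have hmaps : MapsTo (fun s => P.T - s) (Icc 0 P.T) (Icc 0 P.T) := fun s hs =>
    ⟨sub_nonneg.2 hs.2, sub_le_self _ hs.1⟩
  have hwc' : ContinuousOn (fun s => w (P.T - s)) (Icc 0 P.T) :=
    hwc.comp (by fun_prop) hmaps
  have hder : ∀ s ∈ Ioo 0 P.T, HasDerivAt (fun s => w (P.T - s)) (-f (w (P.T - s))) s := by
    intro s hs
    have hs' : P.T - s ∈ Ioo 0 P.T := ⟨sub_pos.2 hs.2, sub_lt_self _ hs.1⟩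
    have h1 := (hw _ (Ioo_subset_Icc_self hs')).hasDerivAt (Icc_mem_nhds hs'.1 hs'.2)
    have h2 : HasDerivAt (fun s => P.T - s) (-1) s := by
      simpa using (hasDerivAt_id s).const_sub P.T
    simpa using! h1.scomp s h2
  refine ⟨fun s => (w (P.T - s)).1, fun s => (w (P.T - s)).2,
    { y_cont := continuous_fst.comp_continuousOn hwc'
      z_cont := continuous_snd.comp_continuousOn hwc'
      forward := fun s hs => ?_
      backward := fun s hs => ?_
      initial := rfl
      terminal := by simp [hw0] }, by simp [hw0]⟩
  · have := (ContinuousLinearMap.fst ℝ H H).hasFDerivAt.comp_hasDerivAt s (hder s hs)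
    simpa [hf, stateField] using! this
  · have := (ContinuousLinearMap.snd ℝ H H).hasFDerivAt.comp_hasDerivAt s (hder s hs)
    simpa [hf, costateField] using! this

/-- With `p` the state at `t₀`, the map `p ↦ y p t - p` is `1/2`-Lipschitz, so `y p t = x` is a
fixed point problem for a contraction. -/
theorem exists_isFBSolution_step {t t₀ K : ℝ} (ht : t ∈ Icc 0 P.T) (ht₀ : t₀ ∈ Icc t P.T)
    (hK : γ + ‖P.BNB‖ * lipConst γ b ν M νT MT m P.T (growthConst γ M νT MT k P.T) ≤ K)
    (hstep : (t₀ - t) * K ≤ 1 / 4)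
    (h : ∀ x, ∃ y z : ℝ → H, P.IsFBSolution (y 0) 0 y z ∧ y t₀ = x) (x : H) :
    ∃ y z : ℝ → H, P.IsFBSolution (y 0) 0 y z ∧ y t = x := by
  have hK0 : 0 ≤ K := le_trans
    (add_nonneg hP.γ_nonneg (mul_nonneg (norm_nonneg _) hP.lipConst_nonneg)) hK
  choose y z hyz hy₀ using h
  have key : ∀ p q, ‖(y p t - p) - (y q t - q)‖ ≤ 1 / 2 * ‖p - q‖ := by
    intro p q
    have hp := (hyz p).restrict ht.1
    have hq := (hyz q).restrict ht.1
    have hsub : Icc t t₀ ⊆ Icc t P.T := Icc_subset_Icc_right ht₀.2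
    have := norm_sub_le_half_of_norm_deriv_le (η := fun s => y p s - y q s) ht₀.1
      ((hp.y_cont.sub hq.y_cont).mono hsub)
      (((hP.continuousOn_stateField hp.y_cont hp.z_cont).sub
        (hP.continuousOn_stateField hq.y_cont hq.z_cont)).mono hsub)
      (fun s hs => (hp.forward s ⟨hs.1, hs.2.trans_le ht₀.2⟩).sub
        (hq.forward s ⟨hs.1, hs.2.trans_le ht₀.2⟩)) hK0
      (fun s hs => by
        refine (hP.norm_stateField_sub_le _ _ _ _).trans ?_
        have h1 := mul_le_mul_of_nonneg_left (hP.norm_costate_sub_le ht hp hq (hsub hs))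
          (norm_nonneg P.BNB)
        have h2 := mul_le_mul_of_nonneg_right hK (norm_nonneg (y p s - y q s))
        linarith) hstep
    simp only [hy₀] at this
    have e : y p t - p - (y q t - q) = y p t - y q t - (p - q) := by abel
    rw [e]
    exact this
  have hcontr : ContractingWith (1 / 2 : ℝ≥0) fun p => x - (y p t - p) := by
    refine ⟨by norm_num [← NNReal.coe_lt_coe], LipschitzWith.of_dist_le_mul fun p q => ?_⟩
    rw [dist_sub_left, dist_eq_norm, dist_eq_norm]
    simpa using key p q
  have hfix := hcontr.fixedPoint_isFixedPt
  set p := hcontr.fixedPoint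
  refine ⟨y p, z p, hyz p, ?_⟩
  have h1 : x - (y p t - p) = p := hfix
  have h2 : x - y p t = 0 := by
    have : x - y p t = x - (y p t - p) - p := by abel
    rw [this, h1, sub_self]
  exact (sub_eq_zero.1 h2).symm

theorem exists_isFBSolution {t : ℝ} (ht : t ∈ Icc 0 P.T) (x : H) :
    ∃ y z : ℝ → H, P.IsFBSolution x t y z := by
  set K := γ + ‖P.BNB‖ * lipConst γ b ν M νT MT m P.T (growthConst γ M νT MT k P.T)
  have hK0 : 0 ≤ K :=
    add_nonneg hP.γ_nonneg (mul_nonneg (norm_nonneg _) hP.lipConst_nonneg)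
  -- The added 1 keeps the step finite and positive even if `K = 0`.
  set τ : ℝ := 1 / (4 * K + 1) with hτ
  have hτ0 : 0 < τ := by positivity
  have hτK : τ * K ≤ 1 / 4 := by
    rw [hτ, div_mul_eq_mul_div, div_le_div_iff₀ (by positivity) (by norm_num)]
    linarith
  have main : ∀ n : ℕ, ∀ t ∈ Icc 0 P.T, P.T - n * τ ≤ t → ∀ x,
      ∃ y z : ℝ → H, P.IsFBSolution (y 0) 0 y z ∧ y t = x := by
    intro n
    induction n with
    | zero =>
      intro t ht h x
      have : t = P.T := le_antisymm ht.2 (by simpa using h)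
      rw [this]
      exact hP.exists_isFBSolution_of_terminal x
    | succ n ih =>
      intro t ht h x
      refine hP.exists_isFBSolution_step (t₀ := min P.T (t + τ)) ht
        ⟨le_min ht.2 (by linarith), min_le_left _ _⟩ le_rfl ?_ (ih _ ?_ ?_) x
      · refine (mul_le_mul_of_nonneg_right ?_ hK0).trans hτK
        linarith [min_le_right P.T (t + τ)]
      · exact ⟨le_min hP.T_pos.le (by linarith [ht.1]), min_le_left _ _⟩
      · refine le_min (by have : 0 ≤ n * τ := by positivity
                          linarith) ?_
        push_cast at h
        linarith
  obtain ⟨n, hn⟩ := exists_nat_ge (P.T / τ)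
  have hn' : P.T ≤ n * τ := (div_le_iff₀ hτ0).1 hn
  obtain ⟨y, z, h, hx⟩ := main n t ht (by linarith [ht.1]) x
  refine ⟨y, z, ?_⟩
  rw [← hx]
  exact h.restrict ht.1

theorem decoupling_eq {t : ℝ} {x : H} {y z : ℝ → H} (ht : t ∈ Icc 0 P.T)
    (h : P.IsFBSolution x t y z) : P.decoupling x t = z t := by
  have hex : ∃ p : (ℝ → H) × (ℝ → H), P.IsFBSolution x t p.1 p.2 := ⟨(y, z), h⟩
  rw [decoupling, dif_pos hex]
  exact (hP.eqOn_of_isFBSolution ht hex.choose_spec h).2 (left_mem_Icc.2 ht.2)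

end Assumptions

end Problem

end HilbertControl

/-! ### Optimality of the feedback and differentiability of the value. -/

namespace HilbertControl

theorem intervalIntegrable_inner_continuousOn {H : Type*} [NormedAddCommGroup H]
    [InnerProductSpace ℝ H] {w z : ℝ → H} {a b : ℝ} (hab : a ≤ b)
    (hw : IntervalIntegrable w volume a b) (hz : ContinuousOn z (Icc a b)) :
    IntervalIntegrable (fun s => inner ℝ (w s) (z s)) volume a b := by
  obtain ⟨C, hC⟩ := isCompact_Icc.exists_bound_of_continuousOn hz
  have hz' : IntervalIntegrable z volume a b := hz.intervalIntegrable_of_Icc hab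
  rw [intervalIntegrable_iff_integrableOn_Ioc_of_le hab] at *
  refine (hw.norm.mul_const C).mono' (hw.aestronglyMeasurable.inner hz'.aestronglyMeasurable) ?_
  filter_upwards [ae_restrict_mem measurableSet_Ioc] with s hs
  exact (norm_inner_le_norm _ _).trans
    (mul_le_mul_of_nonneg_left (hC s (Ioc_subset_Icc_self hs)) (norm_nonneg _))

theorem integrable_inner_self_apply {U α : Type*} [NormedAddCommGroup U] [InnerProductSpace ℝ U]
    [MeasurableSpace α] {μ : Measure α} {v : α → U} (hv : MemLp v 2 μ) (N : U →L[ℝ] U) :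
    Integrable (fun s => inner ℝ (v s) (N (v s))) μ := by
  refine ((hv.integrable_norm_pow two_ne_zero).const_mul ‖N‖).mono'
    (hv.1.inner (N.continuous.comp_aestronglyMeasurable hv.1)) (Filter.Eventually.of_forall ?_)
  intro s
  refine (norm_inner_le_norm _ _).trans ?_
  have := mul_le_mul_of_nonneg_left (N.le_opNorm (v s)) (norm_nonneg (v s))
  linarith

theorem memLp_two_of_continuousOn_Icc {U : Type*} [NormedAddCommGroup U] {u : ℝ → U} {a b : ℝ}
    (hab : a ≤ b) (hu : ContinuousOn u (Icc a b)) : MemLp u 2 (volume.restrict (Ioc a b)) := by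
  obtain ⟨C, hC⟩ := isCompact_Icc.exists_bound_of_continuousOn hu
  have hi : IntervalIntegrable u volume a b := hu.intervalIntegrable_of_Icc hab
  rw [intervalIntegrable_iff_integrableOn_Ioc_of_le hab] at hi
  refine MemLp.of_bound hi.aestronglyMeasurable C ?_
  filter_upwards [ae_restrict_mem measurableSet_Ioc] with s hs
  exact hC s (Ioc_subset_Icc_self hs)

/-- A function satisfying a two-sided first order inequality with a Lipschitz subgradient field is
differentiable. -/
theorem hasGradientAt_of_subgradient_of_lipschitz {H : Type*} [NormedAddCommGroup H]
    [InnerProductSpace ℝ H] [CompleteSpace H] {f : H → ℝ} {g : H → H} {L : ℝ} (hL : 0 ≤ L)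
    (hf : ∀ x y, f x + inner ℝ (y - x) (g x) ≤ f y) (hg : ∀ x y, ‖g x - g y‖ ≤ L * ‖x - y‖)
    (x : H) : HasGradientAt f (g x) x := by
  -- The subgradient inequalities at `x` and at `y` bound the first order error between `0` and `L
  -- ‖y - x‖²`.
  rw [hasGradientAt_iff_isLittleO, Asymptotics.isLittleO_iff]
  intro c hc
  filter_upwards [Metric.ball_mem_nhds x (show 0 < c / (L + 1) by positivity)] with y hy
  rw [Metric.mem_ball, dist_eq_norm, lt_div_iff₀ (by positivity)] at hy
  have h1 := hf x y
  have h2 := hf y x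
  have h3 : inner ℝ (y - x) (g y - g x) ≤ L * ‖y - x‖ * ‖y - x‖ := by
    refine (real_inner_le_norm _ _).trans ?_
    rw [mul_comm]
    exact mul_le_mul_of_nonneg_right (hg y x) (norm_nonneg _)
  have h4 : L * ‖y - x‖ * ‖y - x‖ ≤ c * ‖y - x‖ :=
    mul_le_mul_of_nonneg_right (by linarith [norm_nonneg (y - x)]) (norm_nonneg _)
  rw [inner_sub_right] at h3
  rw [← neg_sub y x, inner_neg_left] at h2
  rw [Real.norm_eq_abs, real_inner_comm, abs_le]
  have : 0 ≤ c * ‖y - x‖ := by positivity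
  constructor <;> linarith

namespace Problem

variable {H U : Type*}
  [NormedAddCommGroup H] [InnerProductSpace ℝ H] [CompleteSpace H]
  [NormedAddCommGroup U] [InnerProductSpace ℝ U] [CompleteSpace U]

/-- The feedback control `-N⁻¹ B* z` associated with a costate `z`. -/
noncomputable def feedback (P : Problem H U) (z : H) : U :=
  -P.N.symm (ContinuousLinearMap.adjoint P.B z)

theorem continuous_feedback (P : Problem H U) : Continuous P.feedback :=
  (P.N.symm.continuous.comp (ContinuousLinearMap.adjoint P.B).continuous).neg

theorem N_feedback (P : Problem H U) (z : H) :
    P.N (P.feedback z) = -ContinuousLinearMap.adjoint P.B z := by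
  simp [feedback]

theorem B_feedback (P : Problem H U) (z : H) : P.B (P.feedback z) = -P.BNB z := by
  simp [feedback, BNB]

namespace Assumptions

variable {P : Problem H U} {γ b ν M νT MT m k : ℝ} (hP : P.Assumptions γ b ν M νT MT m k)

include hP

theorem inner_N_comm (u v : U) : inner ℝ u (P.N v) = inner ℝ v (P.N u) := by
  have h := hP.N_selfAdjoint
  rw [ContinuousLinearMap.isSelfAdjoint_iff_isSymmetric] at h
  rw [real_inner_comm]
  exact h v u

variable {t : ℝ} {x : H} {y z : ℝ → H}

theorem isState_feedback (h : P.IsFBSolution x t y z) :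
    P.IsState x t (fun s => P.feedback (z s)) y := by
  refine ⟨h.y_cont, fun s hs => ?_⟩
  have hsub : Icc t s ⊆ Icc t P.T := Icc_subset_Icc_right hs.2
  have h1 := intervalIntegral.integral_eq_sub_of_hasDerivAt_of_le hs.1 (h.y_cont.mono hsub)
    (fun r hr => h.forward r ⟨hr.1, hr.2.trans_le hs.2⟩)
    (((hP.continuousOn_stateField h.y_cont h.z_cont).mono hsub).intervalIntegrable_of_Icc hs.1)
  simp only [B_feedback, ← sub_eq_add_neg]
  rw [h1, h.initial]
  abel

theorem intervalIntegrable_drift {x' : H} {v : ℝ → U} {X : ℝ → H} (ht : t ≤ P.T)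
    (hv : MemLp v 2 (volume.restrict (Ioc t P.T))) (hX : P.IsState x' t v X) :
    IntervalIntegrable (fun s => P.A (X s) + P.B (v s)) volume t P.T := by
  refine ((hP.continuous_A.comp_continuousOn hX.1).intervalIntegrable_of_Icc ht).add ?_
  rw [intervalIntegrable_iff_integrableOn_Ioc_of_le ht]
  exact P.B.integrable_comp (hv.integrable one_le_two)

/-- The excess of the running Hamiltonian over its expansion along the extremal is nonnegative. -/
theorem running_excess_nonneg {X y z : H} {v : U} {C : ℝ} (hC : 0 ≤ C) (hz : ‖z‖ ≤ C * ‖y‖)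
    (hνC : 0 ≤ ν - b * C) :
    0 ≤ (P.F X - P.F y) + 1 / 2 * (inner ℝ v (P.N v)
        - inner ℝ (P.feedback z) (P.N (P.feedback z)))
      + (inner ℝ (P.A X + P.B v - P.stateField y z) z
        + inner ℝ (X - y) (P.costateField y z)) := by
  set u := P.feedback z with hu
  have e1 : inner ℝ (P.A X + P.B v - P.stateField y z) z
        + inner ℝ (X - y) (P.costateField y z)
      = inner ℝ (P.A X - P.A y - fderiv ℝ P.A y (X - y)) z
        + inner ℝ (P.B (v - u)) z - inner ℝ (gradient P.F y) (X - y) := by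
    rw [map_sub P.B, hu, B_feedback, stateField, costateField, inner_neg_right, inner_add_right,
      ContinuousLinearMap.adjoint_inner_right, real_inner_comm (gradient P.F y)]
    simp only [inner_sub_left, inner_add_left, inner_neg_left]
    ring
  have e2 : inner ℝ (P.B (v - u)) z = -inner ℝ (v - u) (P.N u) := by
    -- Stationarity of the Hamiltonian, `N u = -B* z`: the control terms then combine into half the
    -- quadratic form of `N` at `v - u`.
    rw [hu, N_feedback, inner_neg_right, neg_neg, ContinuousLinearMap.adjoint_inner_right]
  have e3 : inner ℝ (v - u) (P.N (v - u))
      = inner ℝ v (P.N v) - inner ℝ u (P.N u) - 2 * inner ℝ (v - u) (P.N u) := by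
    simp only [map_sub, inner_sub_left, inner_sub_right]
    rw [hP.inner_N_comm u v]
    ring
  have h1 := hP.N_nonneg (v - u)
  have h2 := add_sq_le_sub_inner_gradient hP.F_C2 hP.F_lower X y
  have h3 := neg_le_of_abs_le (hP.abs_inner_A_remainder_le (x := X) hC hz)
  have h4 : 0 ≤ (ν - b * C) / 2 * ‖X - y‖ ^ 2 := by positivity
  rw [e1, e2]
  linarith

/-- The payoff of an arbitrary control started at `x'` dominates the affine function with slope
`z(t)` determined by the extremal started at `x`. -/
theorem cost_feedback_add_inner_le (ht : t ∈ Icc 0 P.T) (h : P.IsFBSolution x t y z) {x' : H}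
    {v : ℝ → U} {X : ℝ → H} (hv : MemLp v 2 (volume.restrict (Ioc t P.T)))
    (hX : P.IsState x' t v X) :
    P.cost t (fun s => P.feedback (z s)) y + inner ℝ (x' - x) (z t) ≤ P.cost t v X := by
  set u : ℝ → U := fun s => P.feedback (z s) with hu
  have hT : t ≤ P.T := ht.2
  have htT : t ∈ Icc t P.T := left_mem_Icc.2 hT
  have hTT : P.T ∈ Icc t P.T := right_mem_Icc.2 hT
  have hi : IntervalIntegrable (fun s => P.A (X s) + P.B (v s)) volume t P.T :=
    hP.intervalIntegrable_drift hT hv hX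
  have hcs := hP.continuousOn_stateField h.y_cont h.z_cont
  have hcc := hP.continuousOn_costateField h.y_cont h.z_cont
  have hw₁ := hi.sub (hcs.intervalIntegrable_of_Icc (μ := volume) hT)
  have hw₂ := hcc.intervalIntegrable_of_Icc (μ := volume) hT
  have hXt : X t = x' := by simpa using hX.2 t htT
  have hδc : ContinuousOn (fun s => X s - y s) (Icc t P.T) := hX.1.sub h.y_cont
  have hδ : ∀ s ∈ Icc t P.T, X s - y s = X t - y t
      + ∫ r in t..s, (P.A (X r) + P.B (v r) - P.stateField (y r) (z r)) := by
    intro s hs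
    have hsub : uIcc t s ⊆ uIcc t P.T := by
      rw [uIcc_of_le hs.1, uIcc_of_le hT]; exact Icc_subset_Icc_right hs.2
    have h1 := intervalIntegral.integral_eq_sub_of_hasDerivAt_of_le hs.1
      (h.y_cont.mono (Icc_subset_Icc_right hs.2))
      (fun r hr => h.forward r ⟨hr.1, hr.2.trans_le hs.2⟩)
      ((hcs.mono (Icc_subset_Icc_right hs.2)).intervalIntegrable_of_Icc hs.1)
    change ∫ r in t..s, P.stateField (y r) (z r) = _ at h1
    rw [intervalIntegral.integral_sub (hi.mono_set hsub)
      ((hcs.mono (Icc_subset_Icc_right hs.2)).intervalIntegrable_of_Icc hs.1), h1,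
      hX.2 s hs, hXt]
    abel
  have hζ : ∀ s ∈ Icc t P.T, z s = z t + ∫ r in t..s, P.costateField (y r) (z r) := by
    intro s hs
    have h1 := intervalIntegral.integral_eq_sub_of_hasDerivAt_of_le hs.1
      (h.z_cont.mono (Icc_subset_Icc_right hs.2))
      (fun r hr => h.backward r ⟨hr.1, hr.2.trans_le hs.2⟩)
      ((hcc.mono (Icc_subset_Icc_right hs.2)).intervalIntegrable_of_Icc hs.1)
    change ∫ r in t..s, P.costateField (y r) (z r) = _ at h1
    rw [h1]
    abel
  have hparts := integral_inner_add_inner hT hw₁ hw₂ hδ hζ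
  have iN : ∀ {w : ℝ → U}, MemLp w 2 (volume.restrict (Ioc t P.T)) →
      IntervalIntegrable (fun s => inner ℝ (w s) (P.N (w s))) volume t P.T := fun hw =>
    (intervalIntegrable_iff_integrableOn_Ioc_of_le hT).2
      (integrable_inner_self_apply hw (P.N : U →L[ℝ] U))
  have hum : MemLp u 2 (volume.restrict (Ioc t P.T)) :=
    memLp_two_of_continuousOn_Icc hT (P.continuous_feedback.comp_continuousOn h.z_cont)
  have iF : ∀ {Y : ℝ → H}, ContinuousOn Y (Icc t P.T) →
      IntervalIntegrable (fun s => P.F (Y s)) volume t P.T := fun hY =>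
    (hP.F_C2.continuous.comp_continuousOn hY).intervalIntegrable_of_Icc hT
  have i₁ := intervalIntegrable_inner_continuousOn hT hw₁ h.z_cont
  have i₂ : IntervalIntegrable (fun s => inner ℝ (X s - y s) (P.costateField (y s) (z s)))
      volume t P.T := (hδc.inner hcc).intervalIntegrable_of_Icc hT
  have hnn := intervalIntegral.integral_nonneg hT (μ := volume) fun s hs =>
    hP.running_excess_nonneg (X := X s) (v := v s) hP.growthConst_nonneg
      (hP.norm_costate_le ht h s hs) hP.sub_growthConst_pos.le
  rw [intervalIntegral.integral_add (((iF hX.1).sub (iF h.y_cont)).add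
      (((iN hv).sub (iN hum)).const_mul _)) (i₁.add i₂),
    intervalIntegral.integral_add ((iF hX.1).sub (iF h.y_cont))
      (((iN hv).sub (iN hum)).const_mul _),
    intervalIntegral.integral_sub (iF hX.1) (iF h.y_cont),
    intervalIntegral.integral_const_mul, intervalIntegral.integral_sub (iN hv) (iN hum),
    hparts] at hnn
  have hterm := add_sq_le_sub_inner_gradient hP.FT_C2 hP.FT_lower (X P.T) (y P.T)
  have hνT := hP.νT_pos
  have : 0 ≤ νT / 2 * ‖X P.T - y P.T‖ ^ 2 := by positivity
  -- The boundary term at `T` becomes the linear part of `FT` at `y T`, which convexity of `FT`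
  -- bounds by the difference of terminal costs.
  rw [hXt, h.initial, h.terminal, real_inner_comm (gradient P.FT (y P.T))] at hnn
  rw [cost, cost]
  linarith

theorem isLeast_payoffs (ht : t ∈ Icc 0 P.T) (h : P.IsFBSolution x t y z) :
    IsLeast (P.payoffs x t) (P.cost t (fun s => P.feedback (z s)) y) := by
  refine ⟨⟨_, y, memLp_two_of_continuousOn_Icc ht.2
    (P.continuous_feedback.comp_continuousOn h.z_cont), hP.isState_feedback h, rfl⟩, ?_⟩
  rintro c ⟨v, X, hv, hX, rfl⟩
  simpa using hP.cost_feedback_add_inner_le ht h hv hX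

/-- The inequality for arbitrary controls from `x'` is applied to the optimal one. -/
theorem value_add_inner_le (ht : t ∈ Icc 0 P.T) (x x' : H) :
    P.value x t + inner ℝ (x' - x) (P.decoupling x t) ≤ P.value x' t := by
  obtain ⟨y, z, h⟩ := hP.exists_isFBSolution ht x
  obtain ⟨y', z', h'⟩ := hP.exists_isFBSolution ht x'
  rw [value, value, (hP.isLeast_payoffs ht h).csInf_eq, (hP.isLeast_payoffs ht h').csInf_eq,
    hP.decoupling_eq ht h]
  exact hP.cost_feedback_add_inner_le ht h (memLp_two_of_continuousOn_Icc ht.2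
    (P.continuous_feedback.comp_continuousOn h'.z_cont)) (hP.isState_feedback h')

theorem norm_decoupling_sub_le (ht : t ∈ Icc 0 P.T) (x x' : H) :
    ‖P.decoupling x t - P.decoupling x' t‖ ≤
      lipConst γ b ν M νT MT m P.T (growthConst γ M νT MT k P.T) * ‖x - x'‖ := by
  obtain ⟨y, z, h⟩ := hP.exists_isFBSolution ht x
  obtain ⟨y', z', h'⟩ := hP.exists_isFBSolution ht x'
  rw [hP.decoupling_eq ht h, hP.decoupling_eq ht h', ← h.initial, ← h'.initial]
  exact hP.norm_costate_sub_le ht h h' (left_mem_Icc.2 ht.2)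

end Assumptions

end Problem

end HilbertControl

theorem mainTheorem7 {H U : Type*}
    [NormedAddCommGroup H] [InnerProductSpace ℝ H] [CompleteSpace H]
    [NormedAddCommGroup U] [InnerProductSpace ℝ U] [CompleteSpace U]
    (P : HilbertControl.Problem H U) (γ b ν M νT MT m k : ℝ)
    (hP : P.Assumptions γ b ν M νT MT m k)
    (x : H) (t : ℝ) (ht : t ∈ Set.Icc 0 P.T) :
    -- the forward-backward system has exactly one solution, and `Γ` decouples it
    (∃ y z : ℝ → H, P.IsFBSolution x t y z ∧
      (∀ s ∈ Set.Icc t P.T, z s = P.decoupling (y s) s) ∧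
      ∀ y' z' : ℝ → H, P.IsFBSolution x t y' z' →
        Set.EqOn y' y (Set.Icc t P.T) ∧ Set.EqOn z' z (Set.Icc t P.T)) ∧
    -- the value function is a genuine infimum
    IsGLB (P.payoffs x t) (P.value x t) ∧
    -- `Γ(x,t) = D_x V(x,t)`
    HasGradientAt (fun ξ => P.value ξ t) (P.decoupling x t) x := by
  obtain ⟨y, z, h⟩ := hP.exists_isFBSolution ht x
  refine ⟨⟨y, z, h, fun s hs => ?_, fun y' z' h' => hP.eqOn_of_isFBSolution ht h' h⟩, ?_, ?_⟩
  · exact (hP.decoupling_eq ⟨ht.1.trans hs.1, hs.2⟩ (h.restrict hs.1)).symm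
  · have hl := hP.isLeast_payoffs ht h
    rw [HilbertControl.Problem.value, hl.csInf_eq]
    exact hl.isGLB
  · exact HilbertControl.hasGradientAt_of_subgradient_of_lipschitz
      (g := fun ξ => P.decoupling ξ t) hP.lipConst_nonneg
      (hP.value_add_inner_le ht) (hP.norm_decoupling_sub_le ht) x
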